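/- Let $k,m,n$ be positive integers and let $C_1\in M_{k,m}(\mathbb C)$, $C_2\in M_{m,n}(\mathbb C)$ have operator norm $\|C_1\|=\|C_2\|=1$. Put $d=k+m+n$ and let $E=(E_1,E_2)$ be the pair of $d\times d$ block matrices $$E_1=\begin{pmatrix}0&C_1&0\\0&0&0\\0&0&0\end{pmatrix},\qquad E_2=\begin{pmatrix}0&0&0\\0&0&C_2\\0&0&0\end{pmatrix}.$$ For $X=(X_1,X_2)\in M_N(\mathbb C)^2$ let $L_E(X)=I-\sum_{j=1}^2E_j\otimes X_j-\sum_{j=1}^2E_j^*\otimes X_j^*$, let $\mathfrak P_E[N]=\{X\in M_N(\mathbb C)^2: L_E(X)\succ0\}$, and let $\mathfrak P_E=(\mathfrak P_E[N])_N$. A free bianalytic map $\varphi:\mathfrak P_E\to\mathfrak P_E$ is a sequence of analytic maps $\varphi[N]:\mathfrak P_E[N]\to\mathfrak P_E[N]$ such that $\varphi(X\oplus Y)=\varphi(X)\oplus\varphi(Y)$ for all $X\in \mathfrak P_E[N]$, $Y\in\mathfrak P_E[M]$, and $\varphi(U^*XU)=U^*\varphi(X)U$ for all $X\in\mathfrak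 P_E[N]$ and all unitary $U\in M_N(\mathbb C)$, and which has an inverse sequence with the same properties. (1) If $C_1^*C_1+C_2C_2^*\preceq I$, then $\mathfrak P_E$ is the free bidisk, that is, $\mathfrak P_E[N]=\{(X_1,X_2)\in M_N(\mathbb C)^2:\|X_1\|<1,\ \|X_2\|<1\}$ for every $N$. (2) Otherwise, for every free bianalytic map $\varphi:\mathfrak P_E\to\mathfrak P_E$ there is $\gamma=(\gamma_1,\gamma_2)\in\mathbb C^2$ with $|\gamma_1|=|\gamma_2|=1$ such that $\varphi(X)=(\gamma_1X_1,\gamma_2X_2)$ for every $N$ and every $X\in\mathfrak P_E[N]$. -/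

import Mathlib

open scoped ComplexOrder Kronecker Matrix Matrix.Norms.L2Operator

noncomputable section

namespace FreeSpec

/-- `g`-tuples of complex `n × n` matrices. Matrices carry the operator norm
(norm of the induced operator between Euclidean spaces). -/
abbrev Tuple (g n : ℕ) : Type := Fin g → Matrix (Fin n) (Fin n) ℂ

/-- Direct sum `X ⊕ Y` of matrix tuples, taken coordinatewise. -/
def directSum {g n m : ℕ} (X : Tuple g n) (Y : Tuple g m) : Tuple g (n + m) :=
  fun j => Matrix.reindex finSumFinEquiv finSumFinEquiv (Matrix.fromBlocks (X j) 0 0 (Y j))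

/-- Unitary conjugation `U^* X U` of a matrix tuple, taken coordinatewise. -/
def conj {g n : ℕ} (U : Matrix (Fin n) (Fin n) ℂ) (X : Tuple g n) : Tuple g n :=
  fun j => Uᴴ * X j * U

/-- Evaluation `Λ_A(X) = ∑ A_j ⊗ X_j` of the homogeneous linear pencil with coefficients `A`. -/
def linearPencil {ι : Type*} {g : ℕ} (A : Fin g → Matrix ι ι ℂ) {n : ℕ} (X : Tuple g n) :
    Matrix (ι × Fin n) (ι × Fin n) ℂ :=
  ∑ j, A j ⊗ₖ X j

/-- Evaluation `L_A(X) = I - Λ_A(X) - Λ_A(X)^*` of the monic linear pencil. -/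
def monicPencil {ι : Type*} [DecidableEq ι] {g : ℕ} (A : Fin g → Matrix ι ι ℂ) {n : ℕ}
    (X : Tuple g n) : Matrix (ι × Fin n) (ι × Fin n) ℂ :=
  1 - linearPencil A X - (linearPencil A X)ᴴ

/-- Level `n` of the interior of the free spectrahedron of `A`:
the tuples `X` with `L_A(X)` positive definite. -/
def interiorSpec {ι : Type*} [Fintype ι] [DecidableEq ι] {g : ℕ} (A : Fin g → Matrix ι ι ℂ)
    (n : ℕ) : Set (Tuple g n) :=
  {X | (monicPencil A X).PosDef}

/-- Level `n` of the free bidisk. -/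
def freeBidisk (n : ℕ) : Set (Tuple 2 n) :=
  {X | ∀ j, ‖X j‖ < 1}

/-- `f = (f n)` is an analytic free map between the interiors of the free spectrahedra of `A` and
`B`. Only the values of `f n` on level `n` of the (open) domain matter. -/
structure IsFreeAnalytic {ι κ : Type*} [Fintype ι] [DecidableEq ι] [Fintype κ] [DecidableEq κ]
    {g h : ℕ} (A : Fin g → Matrix ι ι ℂ) (B : Fin h → Matrix κ κ ℂ)
    (f : ∀ n, Tuple g n → Tuple h n) : Prop where
  mapsTo : ∀ n, Set.MapsTo (f n) (interiorSpec A n) (interiorSpec B n)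
  map_directSum : ∀ n m, ∀ X ∈ interiorSpec A n, ∀ Y ∈ interiorSpec A m,
    f (n + m) (directSum X Y) = directSum (f n X) (f m Y)
  map_conj : ∀ n, ∀ X ∈ interiorSpec A n, ∀ U ∈ Matrix.unitaryGroup (Fin n) ℂ,
    f n (conj U X) = conj U (f n X)
  analytic : ∀ n, AnalyticOnNhd ℂ (f n) (interiorSpec A n)

/-- `f` is a free bianalytic map: it is free analytic and has a free analytic inverse. -/
def IsFreeBianalytic {ι κ : Type*} [Fintype ι] [DecidableEq ι] [Fintype κ] [DecidableEq κ]
    {g h : ℕ} (A : Fin g → Matrix ι ι ℂ) (B : Fin h → Matrix κ κ ℂ)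
    (f : ∀ n, Tuple g n → Tuple h n) : Prop :=
  IsFreeAnalytic A B f ∧ ∃ f' : ∀ n, Tuple h n → Tuple g n, IsFreeAnalytic B A f' ∧
    ∀ n, Set.InvOn (f' n) (f n) (interiorSpec A n) (interiorSpec B n)

/-- The pair `E = (E₁, E₂)` of `3 × 3` block matrices: `E₁` has the block `C₁` in position `(1,2)`,
`E₂` has the block `C₂` in position `(2,3)`, and all other blocks vanish. -/
def blockPair {k m n : ℕ} (C₁ : Matrix (Fin k) (Fin m) ℂ) (C₂ : Matrix (Fin m) (Fin n) ℂ) :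
    Fin 2 → Matrix (Fin k ⊕ (Fin m ⊕ Fin n)) (Fin k ⊕ (Fin m ⊕ Fin n)) ℂ :=
  ![Matrix.fromBlocks 0 (Matrix.fromCols C₁ 0) 0 0,
    Matrix.fromBlocks 0 0 0 (Matrix.fromBlocks 0 C₂ 0 0)]

end FreeSpec

end

/-! A Schur complement in the middle block turns positivity of the pencil into `‖(C₁ ⊗ X₀)q‖² + ‖(C₂
⊗ X₁)ᴴq‖² < ‖q‖²` for all nonzero `q` (`mem_interiorSpec_iff`). Product vectors `v ⊗ w`, with `v`
norming `C₁` or `C₂ᴴ`, put the spectrahedron inside the bidisk. When `C₁ᴴC₁ + C₂C₂ᴴ` is a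
contraction, an explicit sum of positive Kronecker products gives the converse.

For a free automorphism, direct sums and unitary conjugation force the value at the origin to be a
scalar pair `b` and the derivative there to be a scalar `2 × 2` matrix `K`. On a superdiagonal tuple
`Z`, conjugation by `diag(1, u, u², …)` rotates `Z`, so each entry of `φ(tZ)` is a monomial in `t`.
Hence `φ` extends along `tZ` to the boundary, where its value is upper triangular with diagonal `b`
and superdiagonal `KZ` (`exists_isBoundaryJet`). It remains in the closed spectrahedron, and
boundary points go to boundary points.

Jets of size two see only the bidisk. The images of the boundary jets `e_p + c e_r`, `|c| ≤ 1`,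
share a kernel vector, and the resulting equations force `K` to be diagonal or antidiagonal, the
entries in row `j` that survive having modulus `1 - |b_j|²` (`originDeriv_dichotomy`). Jets of size
three see the failure of contractivity: with `s⁻²` the norm of `C₁ᴴC₁ + C₂C₂ᴴ`, weighted shifts with
weights `1` and `s` map to Möbius transforms of such shifts, and these leave the closed
spectrahedron unless `b = 0` and `K` is diagonal (`eq_zero_of_diagonal_jet`,
`false_of_antidiagonal_jet`). Cartan's uniqueness theorem then makes `φ` linear (`map_eq_rotation`).
-/

noncomputable section

namespace FreeSpec

/-! ### Holomorphic maps on balanced domains and on the disk -/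

section Holomorphic

open Metric Asymptotics Filter Set Topology

variable {V : Type*} [NormedAddCommGroup V] [NormedSpace ℂ V]

/-- Cartan's uniqueness theorem on a bounded open balanced set. -/
theorem eqOn_id_of_hasStrictFDerivAt_id {D : Set V} {f : V → V} {R : ℝ}
    (hbal : ∀ x ∈ D, ∀ t : ℂ, ‖t‖ < 1 → t • x ∈ D) (hbdd : ∀ x ∈ D, ‖x‖ ≤ R)
    (hmaps : MapsTo f D D) (hdiff : ∀ x ∈ D, DifferentiableAt ℂ f x) (h0 : f 0 = 0)
    (hf : HasStrictFDerivAt f (ContinuousLinearMap.id ℂ V) 0) : EqOn f id D := by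
  intro X hX
  have hmem : ∀ t ∈ ball (0 : ℂ) 1, t • X ∈ D := fun t ht => hbal X hX t (by simpa using ht)
  have hiter : ∀ n : ℕ, MapsTo f^[n] D D := fun n => hmaps.iterate n
  have hiter0 : ∀ n : ℕ, f^[n] 0 = 0 := fun n => Function.iterate_fixed h0 n
  have hdiffn : ∀ n : ℕ, ∀ x ∈ D, DifferentiableAt ℂ f^[n] x := by
    intro n
    induction n with
    | zero => intro x _; simp
    | succ n ih =>
      intro x hx
      rw [Function.iterate_succ']
      exact (hdiff _ (hiter n hx)).comp x (ih x hx)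
  set u : ℕ → ℂ → V := fun n t => f^[n] (t • X) - t • X with hu
  have hu0 : ∀ n, u n 0 = 0 := fun n => by simp [hu, hiter0]
  have hud : ∀ n, DifferentiableOn ℂ (u n) (ball 0 1) := by
    intro n t ht
    have h1 : DifferentiableAt ℂ (fun t : ℂ => t • X) t := by fun_prop
    exact (((hdiffn n _ (hmem t ht)).comp t h1).sub h1).differentiableWithinAt
  have hub : ∀ n, MapsTo (u n) (ball 0 1) (closedBall (u n 0) (R + R)) := by
    intro n t ht
    rw [hu0, mem_closedBall_zero_iff]
    exact (norm_sub_le _ _).trans (add_le_add (hbdd _ (hiter n (hmem t ht))) (hbdd _ (hmem t ht)))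
  -- Higher-order Schwarz lemma. The constant `R + R` does not depend on the iterate `n`, which
  -- drives the whole argument.
  have hschwarz : ∀ (n k : ℕ), u n =o[𝓝 0] (fun t : ℂ => ‖t‖ ^ k) →
      ∀ t ∈ ball (0 : ℂ) 1, ‖u n t‖ ≤ (R + R) * ‖t‖ ^ (k + 1) := by
    intro n k h t ht
    have := Complex.dist_le_mul_div_pow_of_mapsTo_ball_of_isLittleO (n := k) (hud n) (hub n)
      (by simpa [hu0] using h) ht
    simpa [hu0] using this
  have hstrict : HasStrictFDerivAt (fun x => f x - x) (0 : V →L[ℂ] V) 0 := by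
    have := hf.sub (hasStrictFDerivAt_id (𝕜 := ℂ) (0 : V))
    rwa [sub_self] at this
  have hline : Tendsto (fun t : ℂ => t • X) (𝓝 0) (𝓝 0) := by
    have : Continuous fun t : ℂ => t • X := by fun_prop
    simpa using this.tendsto 0
  have hgo : ∀ k : ℕ, u 1 =o[𝓝 0] (fun t : ℂ => ‖t‖ ^ (k + 1)) := by
    intro k
    induction k with
    | zero =>
      have h1 := hstrict.hasFDerivAt.isLittleO
      simp only [sub_zero, h0, zero_apply] at h1
      have h2 := (h1.comp_tendsto hline).trans_isBigO
        (k := fun t : ℂ => ‖t‖ ^ (0 + 1)) (by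
          refine IsBigO.of_bound ‖X‖ (Eventually.of_forall fun t => ?_)
          simp [norm_smul, mul_comm])
      simpa [hu, Function.comp_def] using h2
    | succ k ih =>
      -- Iterating multiplies the leading term of `f - id` by `n`, while the Schwarz bound is
      -- uniform in `n`; so that term must vanish.
      have key : ∀ n : ℕ, (fun t => u n t - (n : ℂ) • u 1 t) =o[𝓝 0]
          (fun t : ℂ => ‖t‖ ^ (k + 1 + 1)) := by
        intro n
        induction n with
        | zero => simp [hu]
        | succ n ihn =>
          have hpow : (fun t : ℂ => ‖t‖ ^ (k + 1 + 1)) =O[𝓝 0] (fun t : ℂ => ‖t‖ ^ (k + 1)) := by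
            refine IsBigO.of_bound 1 ?_
            filter_upwards [ball_mem_nhds (0 : ℂ) one_pos] with t ht
            have ht' : ‖t‖ ≤ 1 := (mem_ball_zero_iff.1 ht).le
            simpa using pow_le_pow_of_le_one (norm_nonneg t) ht' (Nat.le_succ (k + 1))
          have hun : u n =o[𝓝 0] (fun t : ℂ => ‖t‖ ^ (k + 1)) := by
            have := (ihn.trans_isBigO hpow).add (ih.const_smul_left (n : ℂ))
            simpa using this
          have hunO : u n =O[𝓝 0] (fun t : ℂ => ‖t‖ ^ (k + 1 + 1)) := by
            refine IsBigO.of_bound (R + R) ?_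
            filter_upwards [ball_mem_nhds (0 : ℂ) one_pos] with t ht
            simpa using hschwarz n (k + 1) hun t ht
          have hcont : Tendsto (fun t : ℂ => f^[n] (t • X)) (𝓝 0) (𝓝 0) := by
            have := ((hdiffn n _ (hmem 0 (by simp))).continuousAt.tendsto).comp
              (by simpa using hline : Tendsto (fun t : ℂ => t • X) (𝓝 0) (𝓝 ((0 : ℂ) • X)))
            simpa [hiter0, Function.comp_def] using this
          -- Strict differentiability makes the increment of `f - id` between `t • X` and `f^[n] (t
          -- • X)` negligible against `u n`, hence `u (n + 1) - u n` equals `u 1` up to higher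
          -- order.
          have hs := hstrict.isLittleO
          have hs2 := (hs.comp_tendsto (k := fun t : ℂ => (f^[n] (t • X), t • X))
            (by simpa using hcont.prodMk_nhds hline)).trans_isBigO hunO
          refine (ihn.add hs2).congr_left fun t => ?_
          simp only [hu, Function.comp_def, Function.iterate_succ_apply',
            zero_apply, Nat.cast_add, Nat.cast_one, add_smul, one_smul,
            Function.iterate_zero, id_eq]
          abel
      have hbound : ∀ n : ℕ, ∀ᶠ t in 𝓝 (0 : ℂ), n * ‖u 1 t‖ ≤ (R + R + 1) * ‖t‖ ^ (k + 1 + 1) := by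
        intro n
        have hpow : (fun t : ℂ => ‖t‖ ^ (k + 1 + 1)) =O[𝓝 0] (fun t : ℂ => ‖t‖ ^ (k + 1)) := by
          refine IsBigO.of_bound 1 ?_
          filter_upwards [ball_mem_nhds (0 : ℂ) one_pos] with t ht
          have ht' : ‖t‖ ≤ 1 := (mem_ball_zero_iff.1 ht).le
          simpa using pow_le_pow_of_le_one (norm_nonneg t) ht' (Nat.le_succ (k + 1))
        have hun : u n =o[𝓝 0] (fun t : ℂ => ‖t‖ ^ (k + 1)) := by
          have := ((key n).trans_isBigO hpow).add (ih.const_smul_left (n : ℂ))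
          simpa using this
        filter_upwards [(key n).bound one_pos, ball_mem_nhds (0 : ℂ) one_pos] with t h1 ht
        have h2 := hschwarz n (k + 1) hun t ht
        have h3 : (n : ℝ) * ‖u 1 t‖ = ‖(n : ℂ) • u 1 t‖ := by simp [norm_smul]
        have h4 : ‖(n : ℂ) • u 1 t‖ ≤ ‖u n t‖ + ‖u n t - (n : ℂ) • u 1 t‖ := by
          have := norm_sub_le (u n t) (u n t - (n : ℂ) • u 1 t)
          simpa using this
        simp only [norm_pow, norm_norm, one_mul] at h1
        rw [h3]
        nlinarith
      refine IsLittleO.of_bound fun c hc => ?_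
      obtain ⟨n, hn⟩ := exists_nat_gt ((|R| + |R| + 1) / c)
      have hn0 : (0 : ℝ) < n := lt_of_le_of_lt (by positivity) hn
      filter_upwards [hbound n] with t ht
      rw [div_lt_iff₀ hc] at hn
      have hp : 0 ≤ ‖t‖ ^ (k + 1 + 1) := by positivity
      rw [norm_pow, norm_norm]
      have h5 : (R + R + 1) * ‖t‖ ^ (k + 1 + 1) ≤ (n * c) * ‖t‖ ^ (k + 1 + 1) :=
        mul_le_mul_of_nonneg_right (by linarith [le_abs_self R]) hp
      have h6 : (n : ℝ) * ‖u 1 t‖ ≤ n * (c * ‖t‖ ^ (k + 1 + 1)) := by linarith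
      exact le_of_mul_le_mul_left h6 hn0
  have hzero : ∀ t ∈ ball (0 : ℂ) 1, u 1 t = 0 := by
    intro t ht
    have ht1 : ‖t‖ < 1 := mem_ball_zero_iff.1 ht
    have hlim : Tendsto (fun k : ℕ => (R + R) * ‖t‖ ^ (k + 1 + 1)) atTop (𝓝 0) := by
      have := (tendsto_pow_atTop_nhds_zero_of_lt_one (norm_nonneg t) ht1).comp
        (tendsto_add_atTop_nat 2)
      simpa [Function.comp_def, add_assoc] using this.const_mul (R + R)
    exact norm_le_zero_iff.1 (ge_of_tendsto' hlim fun k => hschwarz 1 (k + 1) (hgo k) t ht)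
  -- Vanishing is known only for `‖t‖ < 1`; the point `X` itself is reached by continuity.
  have hseq : Tendsto (fun n : ℕ => ((1 : ℂ) - 1 / ((n : ℂ) + 1)) • X) atTop (𝓝 X) := by
    have := (tendsto_const_nhds (x := (1 : ℂ))).sub
      (tendsto_one_div_add_atTop_nhds_zero_nat (𝕜 := ℂ))
    simpa using this.smul_const X
  have hlim1 := ((hdiff X hX).continuousAt.tendsto.comp hseq).sub hseq
  have hlim2 : Tendsto (fun n : ℕ => u 1 ((1 : ℂ) - 1 / ((n : ℂ) + 1))) atTop (𝓝 (0 : V)) := by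
    refine tendsto_const_nhds.congr fun n => (hzero _ ?_).symm
    rw [mem_ball_zero_iff]
    have hn : (0 : ℝ) < n + 1 := by positivity
    have hr : (1 : ℂ) - 1 / ((n : ℂ) + 1) = ((1 - 1 / ((n : ℝ) + 1) : ℝ) : ℂ) := by push_cast; rfl
    rw [hr, Complex.norm_real, Real.norm_eq_abs, abs_lt]
    have h1 : 1 / ((n : ℝ) + 1) ≤ 1 := by rw [div_le_one hn]; linarith [Nat.cast_nonneg (α := ℝ) n]
    have h2 : 0 < 1 / ((n : ℝ) + 1) := by positivity
    constructor <;> linarith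
  exact sub_eq_zero.1 (tendsto_nhds_unique hlim1 hlim2)

theorem eqOn_closedBall_of_eqOn_sphere {g h : ℂ → V} {r : ℝ} (hr : 1 < r)
    (hg : DifferentiableOn ℂ g (ball 0 r)) (hh : DifferentiableOn ℂ h (ball 0 r))
    (heq : ∀ u : ℂ, ‖u‖ = 1 → g u = h u) {u : ℂ} (hu : ‖u‖ ≤ 1) : g u = h u := by
  have hcl : closure (ball (0 : ℂ) 1) ⊆ ball 0 r := by
    rw [closure_ball _ one_ne_zero]
    exact closedBall_subset_ball hr
  refine Complex.eqOn_closure_of_eqOn_frontier isBounded_ball (hg.mono hcl).diffContOnCl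
    (hh.mono hcl).diffContOnCl (fun v hv => heq v ?_) ?_
  · rw [frontier_ball _ one_ne_zero] at hv
    simpa using hv
  · rw [closure_ball _ one_ne_zero]
    simpa using hu

/-- The radius beyond `1` leaves room to apply the maximum principle on the closed unit disk in `u`.
-/
theorem differentiableOn_comp_mul {g : ℂ → V} (hg : DifferentiableOn ℂ g (ball 0 1)) {t : ℂ}
    (ht : ‖t‖ < 1) : ∃ r > 1, DifferentiableOn ℂ (fun u : ℂ => g (u * t)) (ball 0 r) := by
  rcases eq_or_ne t 0 with rfl | h0
  · exact ⟨2, by norm_num, by simp⟩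
  · have hpos : 0 < ‖t‖ := norm_pos_iff.2 h0
    refine ⟨‖t‖⁻¹, (one_lt_inv₀ hpos).2 ht, hg.comp (by fun_prop) fun u hu => ?_⟩
    rw [mem_ball_zero_iff] at hu ⊢
    rw [norm_mul]
    calc ‖u‖ * ‖t‖ < ‖t‖⁻¹ * ‖t‖ := by gcongr
      _ = 1 := inv_mul_cancel₀ hpos.ne'

/-- A holomorphic function on the disk which is homogeneous of degree `p` under rotations is a
monomial. -/
theorem exists_eq_pow_smul {g : ℂ → V} (hg : DifferentiableOn ℂ g (ball 0 1)) (p : ℕ)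
    (hrot : ∀ u t : ℂ, ‖u‖ = 1 → ‖t‖ < 1 → g (u * t) = u ^ p • g t) :
    ∃ q : V, ∀ t : ℂ, ‖t‖ < 1 → g t = t ^ p • q := by
  -- Both sides are holomorphic in `u`, so the rotation law extends inward from the circle. Then the
  -- smaller of `t` and `1 / 2` is a multiple of the other, and `g (1 / 2)` determines `g`.
  have hdisk : ∀ u t : ℂ, ‖u‖ ≤ 1 → ‖t‖ < 1 → g (u * t) = u ^ p • g t := by
    intro u t hu ht
    obtain ⟨r, hr, hd⟩ := differentiableOn_comp_mul hg ht
    exact eqOn_closedBall_of_eqOn_sphere (h := fun u => u ^ p • g t) hr hd (by fun_prop)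
      (fun v hv => hrot v t hv ht) hu
  have hhalf : ‖(1 / 2 : ℂ)‖ = 1 / 2 := by simp
  refine ⟨(2 : ℂ) ^ p • g (1 / 2), fun t ht => ?_⟩
  rcases le_total ‖t‖ (1 / 2) with h | h
  · have := hdisk (2 * t) (1 / 2) (by simp; linarith) (by rw [hhalf]; norm_num)
    rw [show 2 * t * (1 / 2) = t by ring] at this
    rw [this, smul_smul, mul_pow, mul_comm]
  · have ht0 : t ≠ 0 := by rintro rfl; simp at h; norm_num at h
    have hle : ‖(1 / 2 : ℂ) / t‖ ≤ 1 := by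
      rw [norm_div, hhalf]
      exact (div_le_one (norm_pos_iff.2 ht0)).2 h
    have := hdisk ((1 / 2) / t) t hle ht
    rw [div_mul_cancel₀ _ ht0] at this
    rw [this, smul_smul, smul_smul, ← mul_pow, ← mul_pow,
      show t * 2 * (1 / 2 / t) = 1 by field_simp, one_pow, one_smul]

/-- A holomorphic function on the disk which is homogeneous of negative degree under rotations
vanishes. -/
theorem eq_zero_of_pow_smul_eq {g : ℂ → V} (hg : DifferentiableOn ℂ g (ball 0 1)) {p : ℕ}
    (hp : p ≠ 0) (hrot : ∀ u t : ℂ, ‖u‖ = 1 → ‖t‖ < 1 → u ^ p • g (u * t) = g t)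
    {t : ℂ} (ht : ‖t‖ < 1) : g t = 0 := by
  obtain ⟨r, hr, hd⟩ := differentiableOn_comp_mul hg ht
  have := eqOn_closedBall_of_eqOn_sphere (g := fun u => u ^ p • g (u * t)) (h := fun _ => g t) hr
    (DifferentiableOn.smul (by fun_prop) hd) (by fun_prop) (fun v hv => hrot v t hv ht)
    (u := 0) (by simp)
  simpa [hp] using this.symm

end Holomorphic

/-! ### Euclidean norms and attained operator norms -/

section SqNorm

variable {ι κ : Type*} [Fintype ι] [Fintype κ]

/-- The square of the Euclidean norm of a complex vector. -/
def sqNorm (v : ι → ℂ) : ℝ := ∑ i, ‖v i‖ ^ 2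

theorem sqNorm_eq_norm_sq (v : ι → ℂ) : sqNorm v = ‖WithLp.toLp 2 v‖ ^ 2 := by
  simp [sqNorm, EuclideanSpace.norm_sq_eq]

theorem sqNorm_nonneg (v : ι → ℂ) : 0 ≤ sqNorm v := Finset.sum_nonneg fun _ _ => by positivity

theorem sqNorm_eq_zero {v : ι → ℂ} : sqNorm v = 0 ↔ v = 0 := by
  simp [sqNorm_eq_norm_sq]

theorem sqNorm_pos {v : ι → ℂ} (hv : v ≠ 0) : 0 < sqNorm v :=
  (sqNorm_nonneg v).lt_of_ne' (mt sqNorm_eq_zero.1 hv)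

theorem star_dotProduct_self (v : ι → ℂ) : star v ⬝ᵥ v = (sqNorm v : ℂ) := by
  simp [sqNorm, dotProduct, Complex.conj_mul']

theorem sqNorm_smul (c : ℂ) (v : ι → ℂ) : sqNorm (c • v) = ‖c‖ ^ 2 * sqNorm v := by
  simp [sqNorm, mul_pow, Finset.mul_sum]

theorem sqNorm_sub (u v : ι → ℂ) :
    sqNorm (u - v) = sqNorm u - 2 * (star u ⬝ᵥ v).re + sqNorm v := by
  have h : star v ⬝ᵥ u = star (star u ⬝ᵥ v) := by rw [Matrix.star_dotProduct]
  have := congrArg Complex.re (star_dotProduct_self (u - v))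
  rw [star_sub, sub_dotProduct, dotProduct_sub, dotProduct_sub, star_dotProduct_self,
    star_dotProduct_self, h] at this
  simp at this
  linarith

theorem norm_star_dotProduct_sq_le (u v : ι → ℂ) : ‖star u ⬝ᵥ v‖ ^ 2 ≤ sqNorm u * sqNorm v := by
  have := norm_inner_le_norm (𝕜 := ℂ) (WithLp.toLp 2 u) (WithLp.toLp 2 v)
  rw [EuclideanSpace.inner_toLp_toLp, dotProduct_comm] at this
  rw [sqNorm_eq_norm_sq, sqNorm_eq_norm_sq, ← mul_pow]
  gcongr

theorem star_dotProduct_mulVec (K : Matrix ι κ ℂ) (u : ι → ℂ) (v : κ → ℂ) :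
    star u ⬝ᵥ (K *ᵥ v) = star (Kᴴ *ᵥ u) ⬝ᵥ v := by
  rw [Matrix.dotProduct_mulVec, Matrix.star_mulVec, Matrix.conjTranspose_conjTranspose]

theorem sqNorm_mulVec (K : Matrix ι κ ℂ) (v : κ → ℂ) :
    (sqNorm (K *ᵥ v) : ℂ) = star v ⬝ᵥ ((Kᴴ * K) *ᵥ v) := by
  rw [← Matrix.mulVec_mulVec, star_dotProduct_mulVec, Matrix.conjTranspose_conjTranspose,
    star_dotProduct_self]

variable [DecidableEq κ]

theorem sqNorm_mulVec_le (K : Matrix ι κ ℂ) (v : κ → ℂ) :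
    sqNorm (K *ᵥ v) ≤ ‖K‖ ^ 2 * sqNorm v := by
  rw [sqNorm_eq_norm_sq, sqNorm_eq_norm_sq, ← mul_pow]
  gcongr
  exact K.l2_opNorm_mulVec (WithLp.toLp 2 v)

/-- Compactness of the unit sphere. Norming vectors of the coefficients are the test vectors used
later. -/
theorem exists_sqNorm_mulVec_eq [Nonempty κ] (K : Matrix ι κ ℂ) :
    ∃ v : κ → ℂ, sqNorm v = 1 ∧ sqNorm (K *ᵥ v) = ‖K‖ ^ 2 := by
  set T := (Matrix.toEuclideanLin (𝕜 := ℂ) (m := ι) (n := κ)).trans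
    LinearMap.toContinuousLinearMap K with hT
  have hcont : ContinuousOn (fun x => ‖T x‖) (Metric.sphere (0 : EuclideanSpace ℂ κ) 1) := by
    fun_prop
  obtain ⟨x, hx, hmax⟩ := (isCompact_sphere (0 : EuclideanSpace ℂ κ) 1).exists_isMaxOn
    (NormedSpace.sphere_nonempty.2 zero_le_one) hcont
  have hx1 : ‖x‖ = 1 := by simpa using hx
  have hle : ‖T‖ ≤ ‖T x‖ := by
    refine ContinuousLinearMap.opNorm_le_of_unit_norm (𝕜 := ℂ) (norm_nonneg _) fun y hy => ?_
    exact hmax (by simpa using hy)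
  have hge : ‖T x‖ ≤ ‖T‖ := by simpa [hx1] using T.le_opNorm x
  refine ⟨WithLp.ofLp x, by simp [sqNorm_eq_norm_sq, hx1], ?_⟩
  rw [sqNorm_eq_norm_sq, Matrix.l2_opNorm_def, ← hT, ← le_antisymm hge hle]
  rfl

theorem norm_lt_one_of_sqNorm_mulVec_lt (K : Matrix ι κ ℂ)
    (h : ∀ v ≠ 0, sqNorm (K *ᵥ v) < sqNorm v) : ‖K‖ < 1 := by
  cases isEmpty_or_nonempty κ
  · have : K = 0 := by ext i j; exact isEmptyElim j
    simp [this]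
  · obtain ⟨v, hv1, hv⟩ := exists_sqNorm_mulVec_eq K
    have hne : v ≠ 0 := by rintro rfl; simp [sqNorm] at hv1
    have := h v hne
    rw [hv, hv1] at this
    nlinarith [norm_nonneg K]

theorem posSemidef_one_sub_conjTranspose_mul_self {K : Matrix ι κ ℂ} (hK : ‖K‖ ≤ 1) :
    (1 - Kᴴ * K).PosSemidef := by
  refine Matrix.PosSemidef.of_dotProduct_mulVec_nonneg
    (Matrix.isHermitian_one.sub (Matrix.isHermitian_conjTranspose_mul_self K)) fun v => ?_
  rw [Matrix.sub_mulVec, dotProduct_sub, ← sqNorm_mulVec, Matrix.one_mulVec, star_dotProduct_self,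
    ← Complex.ofReal_sub]
  have h1 := sqNorm_mulVec_le K v
  have h2 : ‖K‖ ^ 2 ≤ 1 := pow_le_one₀ (norm_nonneg _) hK
  have : 0 ≤ sqNorm v - sqNorm (K *ᵥ v) := by nlinarith [sqNorm_nonneg v]
  exact_mod_cast this

end SqNorm

/-! ### The pencil as a quadratic form -/

section Pencil

variable {k m n N : ℕ} (C₁ : Matrix (Fin k) (Fin m) ℂ) (C₂ : Matrix (Fin m) (Fin n) ℂ)

/-- The tuples `X` at which the monic pencil is positive semidefinite. -/
def closedSpec {ι : Type*} [Fintype ι] [DecidableEq ι] {g : ℕ} (A : Fin g → Matrix ι ι ℂ)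
    (n : ℕ) : Set (Tuple g n) :=
  {X | (monicPencil A X).PosSemidef}

variable (x : (Fin k ⊕ (Fin m ⊕ Fin n)) × Fin N → ℂ)

/-- The first block of a vector. -/
def blk₁ : Fin k × Fin N → ℂ := fun i => x (Sum.inl i.1, i.2)

/-- The second block of a vector. -/
def blk₂ : Fin m × Fin N → ℂ := fun i => x (Sum.inr (Sum.inl i.1), i.2)

/-- The third block of a vector. -/
def blk₃ : Fin n × Fin N → ℂ := fun i => x (Sum.inr (Sum.inr i.1), i.2)

variable {x} in
theorem eq_zero_of_blk (h₁ : blk₁ x = 0) (h₂ : blk₂ x = 0) (h₃ : blk₃ x = 0) : x = 0 := by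
  ext ⟨i, a⟩
  rcases i with i | i | i
  · exact congrFun h₁ (i, a)
  · exact congrFun h₂ (i, a)
  · exact congrFun h₃ (i, a)

theorem blk₁_linearPencil_mulVec (X : Tuple 2 N) :
    blk₁ (linearPencil (blockPair C₁ C₂) X *ᵥ x) = (C₁ ⊗ₖ X 0) *ᵥ blk₂ x := by
  ext ⟨i, a⟩
  simp [blk₁, blk₂, linearPencil, blockPair, Fin.sum_univ_two, Matrix.mulVec, dotProduct,
    Fintype.sum_prod_type]

theorem blk₂_linearPencil_mulVec (X : Tuple 2 N) :
    blk₂ (linearPencil (blockPair C₁ C₂) X *ᵥ x) = (C₂ ⊗ₖ X 1) *ᵥ blk₃ x := by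
  ext ⟨i, a⟩
  simp [blk₃, blk₂, linearPencil, blockPair, Fin.sum_univ_two, Matrix.mulVec, dotProduct,
    Fintype.sum_prod_type]

theorem blk₃_linearPencil_mulVec (X : Tuple 2 N) :
    blk₃ (linearPencil (blockPair C₁ C₂) X *ᵥ x) = 0 := by
  ext ⟨i, a⟩
  simp [blk₃, linearPencil, blockPair, Fin.sum_univ_two, Matrix.mulVec, dotProduct,
    Fintype.sum_prod_type]

theorem blk₁_linearPencil_conjTranspose_mulVec (X : Tuple 2 N) :
    blk₁ ((linearPencil (blockPair C₁ C₂) X)ᴴ *ᵥ x) = 0 := by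
  ext ⟨i, a⟩
  simp [blk₁, linearPencil, blockPair, Fin.sum_univ_two, Matrix.mulVec, dotProduct,
    Fintype.sum_prod_type]

theorem blk₂_linearPencil_conjTranspose_mulVec (X : Tuple 2 N) :
    blk₂ ((linearPencil (blockPair C₁ C₂) X)ᴴ *ᵥ x) = (C₁ ⊗ₖ X 0)ᴴ *ᵥ blk₁ x := by
  ext ⟨i, a⟩
  simp [blk₁, blk₂, linearPencil, blockPair, Fin.sum_univ_two, Matrix.mulVec, dotProduct,
    Fintype.sum_prod_type]

theorem blk₃_linearPencil_conjTranspose_mulVec (X : Tuple 2 N) :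
    blk₃ ((linearPencil (blockPair C₁ C₂) X)ᴴ *ᵥ x) = (C₂ ⊗ₖ X 1)ᴴ *ᵥ blk₂ x := by
  ext ⟨i, a⟩
  simp [blk₃, blk₂, linearPencil, blockPair, Fin.sum_univ_two, Matrix.mulVec, dotProduct,
    Fintype.sum_prod_type]

theorem star_dotProduct_eq_blk (y : (Fin k ⊕ (Fin m ⊕ Fin n)) × Fin N → ℂ) :
    star x ⬝ᵥ y = star (blk₁ x) ⬝ᵥ blk₁ y + star (blk₂ x) ⬝ᵥ blk₂ y + star (blk₃ x) ⬝ᵥ blk₃ y := by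
  simp [dotProduct, blk₁, blk₂, blk₃, Fintype.sum_prod_type, add_assoc]

theorem star_dotProduct_linearPencil_mulVec (X : Tuple 2 N) :
    star x ⬝ᵥ (linearPencil (blockPair C₁ C₂) X *ᵥ x) =
      star (blk₁ x) ⬝ᵥ ((C₁ ⊗ₖ X 0) *ᵥ blk₂ x) + star (blk₂ x) ⬝ᵥ ((C₂ ⊗ₖ X 1) *ᵥ blk₃ x) := by
  rw [star_dotProduct_eq_blk, blk₁_linearPencil_mulVec, blk₂_linearPencil_mulVec,
    blk₃_linearPencil_mulVec, dotProduct_zero, add_zero]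

theorem monicPencil_isHermitian {ι : Type*} [DecidableEq ι] {g : ℕ} (A : Fin g → Matrix ι ι ℂ)
    (X : Tuple g N) : (monicPencil A X).IsHermitian := by
  simp only [Matrix.IsHermitian, monicPencil, Matrix.conjTranspose_sub, Matrix.conjTranspose_one,
    Matrix.conjTranspose_conjTranspose]
  abel

/-- The quadratic form of the pencil as a real number. -/
theorem star_dotProduct_monicPencil_mulVec (X : Tuple 2 N) :
    star x ⬝ᵥ (monicPencil (blockPair C₁ C₂) X *ᵥ x) =
      ((sqNorm (blk₁ x - (C₁ ⊗ₖ X 0) *ᵥ blk₂ x) + sqNorm (blk₃ x - (C₂ ⊗ₖ X 1)ᴴ *ᵥ blk₂ x) +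
        (sqNorm (blk₂ x) - sqNorm ((C₁ ⊗ₖ X 0) *ᵥ blk₂ x) -
          sqNorm ((C₂ ⊗ₖ X 1)ᴴ *ᵥ blk₂ x)) : ℝ) : ℂ) := by
  set c := star x ⬝ᵥ (linearPencil (blockPair C₁ C₂) X *ᵥ x) with hc
  have h1 : star x ⬝ᵥ ((linearPencil (blockPair C₁ C₂) X)ᴴ *ᵥ x) = star c := by
    rw [hc, star_dotProduct_mulVec, Matrix.conjTranspose_conjTranspose, Matrix.star_dotProduct]
  have h2 : star (blk₂ x) ⬝ᵥ ((C₂ ⊗ₖ X 1) *ᵥ blk₃ x) =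
      star (star (blk₃ x) ⬝ᵥ ((C₂ ⊗ₖ X 1)ᴴ *ᵥ blk₂ x)) := by
    rw [star_dotProduct_mulVec, Matrix.star_dotProduct]
  have h3 : star x ⬝ᵥ x = ((sqNorm (blk₁ x) + sqNorm (blk₂ x) + sqNorm (blk₃ x) : ℝ) : ℂ) := by
    rw [star_dotProduct_eq_blk, star_dotProduct_self, star_dotProduct_self, star_dotProduct_self]
    push_cast
    ring
  have h4 : c + star c = ((2 * (star (blk₁ x) ⬝ᵥ ((C₁ ⊗ₖ X 0) *ᵥ blk₂ x)).re +
      2 * (star (blk₃ x) ⬝ᵥ ((C₂ ⊗ₖ X 1)ᴴ *ᵥ blk₂ x)).re : ℝ) : ℂ) := by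
    have : c + star c = ((2 * c.re : ℝ) : ℂ) := by
      simpa using Complex.add_conj c
    rw [this, hc, star_dotProduct_linearPencil_mulVec, h2]
    simp [mul_add]
  rw [monicPencil, Matrix.sub_mulVec, Matrix.sub_mulVec, dotProduct_sub, dotProduct_sub, h1, ← hc,
    Matrix.one_mulVec, h3, sub_sub, h4, sqNorm_sub, sqNorm_sub, ← Complex.ofReal_sub]
  congr 1
  ring

/-- A vector with prescribed blocks. -/
def ofBlk (p : Fin k × Fin N → ℂ) (q : Fin m × Fin N → ℂ) (s : Fin n × Fin N → ℂ) :
    (Fin k ⊕ (Fin m ⊕ Fin n)) × Fin N → ℂ :=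
  fun i => Sum.elim (fun a => p (a, i.2)) (Sum.elim (fun a => q (a, i.2)) fun a => s (a, i.2)) i.1

variable {C₁ C₂}

/-- The Schur complement with respect to the outer blocks: the form is two squares plus the defect
of the middle block. -/
theorem mem_closedSpec_iff {X : Tuple 2 N} : X ∈ closedSpec (blockPair C₁ C₂) N ↔
    ∀ q, sqNorm ((C₁ ⊗ₖ X 0) *ᵥ q) + sqNorm ((C₂ ⊗ₖ X 1)ᴴ *ᵥ q) ≤ sqNorm q := by
  constructor
  · intro h q
    -- These outer blocks annihilate both squares and leave the defect at `q`.
    have := h.dotProduct_mulVec_nonneg (ofBlk ((C₁ ⊗ₖ X 0) *ᵥ q) q ((C₂ ⊗ₖ X 1)ᴴ *ᵥ q))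
    rw [star_dotProduct_monicPencil_mulVec, Complex.zero_le_real] at this
    change 0 ≤ sqNorm ((C₁ ⊗ₖ X 0) *ᵥ q - (C₁ ⊗ₖ X 0) *ᵥ q) +
      sqNorm ((C₂ ⊗ₖ X 1)ᴴ *ᵥ q - (C₂ ⊗ₖ X 1)ᴴ *ᵥ q) +
      (sqNorm q - sqNorm ((C₁ ⊗ₖ X 0) *ᵥ q) - sqNorm ((C₂ ⊗ₖ X 1)ᴴ *ᵥ q)) at this
    rw [sub_self, sub_self, sqNorm_eq_zero.2 rfl, sqNorm_eq_zero.2 rfl] at this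
    linarith
  · intro h
    refine Matrix.PosSemidef.of_dotProduct_mulVec_nonneg (monicPencil_isHermitian _ _) fun x => ?_
    rw [star_dotProduct_monicPencil_mulVec, Complex.zero_le_real]
    have := h (blk₂ x)
    have h1 := sqNorm_nonneg (blk₁ x - (C₁ ⊗ₖ X 0) *ᵥ blk₂ x)
    have h2 := sqNorm_nonneg (blk₃ x - (C₂ ⊗ₖ X 1)ᴴ *ᵥ blk₂ x)
    linarith

theorem mem_interiorSpec_iff {X : Tuple 2 N} : X ∈ interiorSpec (blockPair C₁ C₂) N ↔
    ∀ q ≠ 0, sqNorm ((C₁ ⊗ₖ X 0) *ᵥ q) + sqNorm ((C₂ ⊗ₖ X 1)ᴴ *ᵥ q) < sqNorm q := by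
  constructor
  · intro h q hq
    have hne : ofBlk ((C₁ ⊗ₖ X 0) *ᵥ q) q ((C₂ ⊗ₖ X 1)ᴴ *ᵥ q) ≠ 0 := by
      intro h0
      refine hq ?_
      change blk₂ (ofBlk ((C₁ ⊗ₖ X 0) *ᵥ q) q ((C₂ ⊗ₖ X 1)ᴴ *ᵥ q)) = 0
      rw [h0]
      rfl
    have := h.dotProduct_mulVec_pos hne
    rw [star_dotProduct_monicPencil_mulVec, Complex.zero_lt_real] at this
    change 0 < sqNorm ((C₁ ⊗ₖ X 0) *ᵥ q - (C₁ ⊗ₖ X 0) *ᵥ q) +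
      sqNorm ((C₂ ⊗ₖ X 1)ᴴ *ᵥ q - (C₂ ⊗ₖ X 1)ᴴ *ᵥ q) +
      (sqNorm q - sqNorm ((C₁ ⊗ₖ X 0) *ᵥ q) - sqNorm ((C₂ ⊗ₖ X 1)ᴴ *ᵥ q)) at this
    rw [sub_self, sub_self, sqNorm_eq_zero.2 rfl, sqNorm_eq_zero.2 rfl] at this
    linarith
  · intro h
    refine Matrix.PosDef.of_dotProduct_mulVec_pos (monicPencil_isHermitian _ _) fun x hx => ?_
    rw [star_dotProduct_monicPencil_mulVec, Complex.zero_lt_real]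
    have h1 := sqNorm_nonneg (blk₁ x - (C₁ ⊗ₖ X 0) *ᵥ blk₂ x)
    have h2 := sqNorm_nonneg (blk₃ x - (C₂ ⊗ₖ X 1)ᴴ *ᵥ blk₂ x)
    by_cases hq : blk₂ x = 0
    · simp only [hq, Matrix.mulVec_zero, sub_zero, sqNorm_eq_zero.2 rfl, add_zero]
      by_cases hp : blk₁ x = 0
      · have hs : blk₃ x ≠ 0 := fun hs => hx (eq_zero_of_blk hp hq hs)
        linarith [sqNorm_nonneg (blk₁ x), sqNorm_pos hs]
      · linarith [sqNorm_nonneg (blk₃ x), sqNorm_pos hp]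
    · linarith [h _ hq]

theorem interiorSpec_subset_closedSpec :
    interiorSpec (blockPair C₁ C₂) N ⊆ closedSpec (blockPair C₁ C₂) N :=
  fun _ hX => Matrix.PosDef.posSemidef hX

end Pencil

/-! ### Membership criteria and comparison with the bidisk -/

section Membership

variable {k m n N : ℕ} {C₁ : Matrix (Fin k) (Fin m) ℂ} {C₂ : Matrix (Fin m) (Fin n) ℂ}

theorem smul_mem_interiorSpec {Z : Tuple 2 N} (hZ : Z ∈ closedSpec (blockPair C₁ C₂) N) {t : ℂ}
    (ht : ‖t‖ < 1) : t • Z ∈ interiorSpec (blockPair C₁ C₂) N := by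
  rw [mem_closedSpec_iff] at hZ
  refine mem_interiorSpec_iff.2 fun q hq => ?_
  have h1 : sqNorm ((C₁ ⊗ₖ (t • Z) 0) *ᵥ q) = ‖t‖ ^ 2 * sqNorm ((C₁ ⊗ₖ Z 0) *ᵥ q) := by
    rw [Pi.smul_apply, Matrix.kronecker_smul, Matrix.smul_mulVec, sqNorm_smul]
  have h2 : sqNorm ((C₂ ⊗ₖ (t • Z) 1)ᴴ *ᵥ q) = ‖t‖ ^ 2 * sqNorm ((C₂ ⊗ₖ Z 1)ᴴ *ᵥ q) := by
    rw [Pi.smul_apply, Matrix.kronecker_smul, Matrix.conjTranspose_smul, Matrix.smul_mulVec,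
      sqNorm_smul, norm_star]
  rw [h1, h2, ← mul_add]
  have h3 : ‖t‖ ^ 2 < 1 := pow_lt_one₀ (norm_nonneg t) ht two_ne_zero
  nlinarith [hZ q, sqNorm_pos hq, sq_nonneg ‖t‖]

theorem smul_mem_interiorSpec_of_mem {X : Tuple 2 N} (hX : X ∈ interiorSpec (blockPair C₁ C₂) N)
    {t : ℂ} (ht : ‖t‖ < 1) : t • X ∈ interiorSpec (blockPair C₁ C₂) N :=
  smul_mem_interiorSpec (interiorSpec_subset_closedSpec hX) ht

theorem circle_smul_mem_closedSpec {X : Tuple 2 N} (hX : X ∈ closedSpec (blockPair C₁ C₂) N)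
    (γ : Fin 2 → ℂ) (hγ : ∀ j, ‖γ j‖ = 1) :
    (fun j => γ j • X j) ∈ closedSpec (blockPair C₁ C₂) N := by
  rw [mem_closedSpec_iff] at hX ⊢
  intro q
  rw [Matrix.kronecker_smul, Matrix.kronecker_smul, Matrix.conjTranspose_smul, Matrix.smul_mulVec,
    Matrix.smul_mulVec, sqNorm_smul, sqNorm_smul, norm_star, hγ, hγ]
  simpa using hX q

theorem circle_smul_mem_interiorSpec {X : Tuple 2 N} (hX : X ∈ interiorSpec (blockPair C₁ C₂) N)
    (γ : Fin 2 → ℂ) (hγ : ∀ j, ‖γ j‖ = 1) :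
    (fun j => γ j • X j) ∈ interiorSpec (blockPair C₁ C₂) N := by
  rw [mem_interiorSpec_iff] at hX ⊢
  intro q
  rw [Matrix.kronecker_smul, Matrix.kronecker_smul, Matrix.conjTranspose_smul, Matrix.smul_mulVec,
    Matrix.smul_mulVec, sqNorm_smul, sqNorm_smul, norm_star, hγ, hγ]
  simpa using hX q

theorem sqNorm_mul_apply {ι κ : Type*} [Fintype ι] [Fintype κ] (v : ι → ℂ) (w : κ → ℂ) :
    sqNorm (fun i : ι × κ => v i.1 * w i.2) = sqNorm v * sqNorm w := by
  simp [sqNorm, Fintype.sum_prod_type, Finset.sum_mul_sum, mul_pow]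

theorem kronecker_mulVec_mul_apply {ι κ ι' κ' : Type*} [Fintype ι] [Fintype κ]
    (K : Matrix ι' ι ℂ) (Y : Matrix κ' κ ℂ) (v : ι → ℂ) (w : κ → ℂ) :
    (K ⊗ₖ Y) *ᵥ (fun i => v i.1 * w i.2) = fun i => (K *ᵥ v) i.1 * (Y *ᵥ w) i.2 := by
  ext ⟨i, a⟩
  simp only [Matrix.mulVec, dotProduct, Fintype.sum_prod_type, Matrix.kroneckerMap_apply,
    Finset.sum_mul_sum]
  exact Finset.sum_congr rfl fun _ _ => Finset.sum_congr rfl fun _ _ => by ring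

/-- Testing on elementary tensors separates the coefficients from `X`; both the bidisk inclusion and
the analysis of size-three jets rest on it. -/
theorem sqNorm_product_le {X : Tuple 2 N} (hX : X ∈ closedSpec (blockPair C₁ C₂) N)
    (v : Fin m → ℂ) (w : Fin N → ℂ) :
    sqNorm (C₁ *ᵥ v) * sqNorm (X 0 *ᵥ w) + sqNorm (C₂ᴴ *ᵥ v) * sqNorm ((X 1)ᴴ *ᵥ w) ≤
      sqNorm v * sqNorm w := by
  have := mem_closedSpec_iff.1 hX (fun i => v i.1 * w i.2)
  rwa [Matrix.conjTranspose_kronecker, kronecker_mulVec_mul_apply, kronecker_mulVec_mul_apply,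
    sqNorm_mul_apply, sqNorm_mul_apply, sqNorm_mul_apply] at this

theorem sqNorm_product_lt {X : Tuple 2 N} (hX : X ∈ interiorSpec (blockPair C₁ C₂) N)
    {v : Fin m → ℂ} {w : Fin N → ℂ} (hv : v ≠ 0) (hw : w ≠ 0) :
    sqNorm (C₁ *ᵥ v) * sqNorm (X 0 *ᵥ w) + sqNorm (C₂ᴴ *ᵥ v) * sqNorm ((X 1)ᴴ *ᵥ w) <
      sqNorm v * sqNorm w := by
  have hne : (fun i : Fin m × Fin N => v i.1 * w i.2) ≠ 0 := by
    intro h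
    have := sqNorm_mul_apply v w
    rw [h, sqNorm_eq_zero.2 rfl] at this
    exact (mul_pos (sqNorm_pos hv) (sqNorm_pos hw)).ne this
  have := mem_interiorSpec_iff.1 hX _ hne
  rwa [Matrix.conjTranspose_kronecker, kronecker_mulVec_mul_apply, kronecker_mulVec_mul_apply,
    sqNorm_mul_apply, sqNorm_mul_apply, sqNorm_mul_apply] at this

theorem nonempty_of_norm_eq_one {p q : ℕ} {C : Matrix (Fin p) (Fin q) ℂ} (hC : ‖C‖ = 1) :
    Nonempty (Fin q) := by
  by_contra h
  rw [not_nonempty_iff] at h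
  have : C = 0 := by ext i j; exact isEmptyElim j
  simp [this] at hC

theorem exists_sqNorm_mulVec_eq_one {p q : ℕ} {C : Matrix (Fin p) (Fin q) ℂ} (hC : ‖C‖ = 1) :
    ∃ v : Fin q → ℂ, sqNorm v = 1 ∧ sqNorm (C *ᵥ v) = 1 := by
  have := nonempty_of_norm_eq_one hC
  obtain ⟨v, hv, hv'⟩ := exists_sqNorm_mulVec_eq C
  exact ⟨v, hv, by rw [hv', hC, one_pow]⟩

theorem ne_zero_of_sqNorm_eq_one {ι : Type*} [Fintype ι] {v : ι → ℂ} (hv : sqNorm v = 1) :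
    v ≠ 0 := by
  rintro rfl
  simp [sqNorm] at hv

theorem sqNorm_mulVec_zero_le (hC₁ : ‖C₁‖ = 1) {X : Tuple 2 N}
    (hX : X ∈ closedSpec (blockPair C₁ C₂) N) (w : Fin N → ℂ) :
    sqNorm (X 0 *ᵥ w) ≤ sqNorm w := by
  obtain ⟨v, hv, hv'⟩ := exists_sqNorm_mulVec_eq_one hC₁
  have := sqNorm_product_le hX v w
  rw [hv, hv'] at this
  nlinarith [mul_nonneg (sqNorm_nonneg (C₂ᴴ *ᵥ v)) (sqNorm_nonneg ((X 1)ᴴ *ᵥ w))]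

theorem sqNorm_conjTranspose_mulVec_one_le (hC₂ : ‖C₂‖ = 1) {X : Tuple 2 N}
    (hX : X ∈ closedSpec (blockPair C₁ C₂) N) (w : Fin N → ℂ) :
    sqNorm ((X 1)ᴴ *ᵥ w) ≤ sqNorm w := by
  obtain ⟨v, hv, hv'⟩ := exists_sqNorm_mulVec_eq_one (C₂.l2_opNorm_conjTranspose.trans hC₂)
  have := sqNorm_product_le hX v w
  rw [hv, hv'] at this
  nlinarith [mul_nonneg (sqNorm_nonneg (C₁ *ᵥ v)) (sqNorm_nonneg (X 0 *ᵥ w))]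

theorem norm_zero_lt_one (hC₁ : ‖C₁‖ = 1) {X : Tuple 2 N}
    (hX : X ∈ interiorSpec (blockPair C₁ C₂) N) : ‖X 0‖ < 1 := by
  obtain ⟨v, hv, hv'⟩ := exists_sqNorm_mulVec_eq_one hC₁
  refine norm_lt_one_of_sqNorm_mulVec_lt _ fun w hw => ?_
  have := sqNorm_product_lt hX (ne_zero_of_sqNorm_eq_one hv) hw
  rw [hv, hv'] at this
  nlinarith [mul_nonneg (sqNorm_nonneg (C₂ᴴ *ᵥ v)) (sqNorm_nonneg ((X 1)ᴴ *ᵥ w))]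

theorem norm_one_lt_one (hC₂ : ‖C₂‖ = 1) {X : Tuple 2 N}
    (hX : X ∈ interiorSpec (blockPair C₁ C₂) N) : ‖X 1‖ < 1 := by
  obtain ⟨v, hv, hv'⟩ := exists_sqNorm_mulVec_eq_one (C₂.l2_opNorm_conjTranspose.trans hC₂)
  rw [← Matrix.l2_opNorm_conjTranspose]
  refine norm_lt_one_of_sqNorm_mulVec_lt _ fun w hw => ?_
  have := sqNorm_product_lt hX (ne_zero_of_sqNorm_eq_one hv) hw
  rw [hv, hv'] at this
  nlinarith [mul_nonneg (sqNorm_nonneg (C₁ *ᵥ v)) (sqNorm_nonneg (X 0 *ᵥ w))]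

theorem interiorSpec_subset_freeBidisk (hC₁ : ‖C₁‖ = 1) (hC₂ : ‖C₂‖ = 1) :
    interiorSpec (blockPair C₁ C₂) N ⊆ freeBidisk N := by
  intro X hX j
  fin_cases j
  · exact norm_zero_lt_one hC₁ hX
  · exact norm_one_lt_one hC₂ hX

theorem mem_closedSpec_of_posSemidef {Z : Tuple 2 N}
    (h : (1 - (C₁ᴴ * C₁) ⊗ₖ ((Z 0)ᴴ * Z 0) - (C₂ * C₂ᴴ) ⊗ₖ (Z 1 * (Z 1)ᴴ)).PosSemidef) :
    Z ∈ closedSpec (blockPair C₁ C₂) N := by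
  refine mem_closedSpec_iff.2 fun q => ?_
  have := h.dotProduct_mulVec_nonneg q
  rw [Matrix.mul_kronecker_mul, Matrix.mul_kronecker_mul, ← Matrix.conjTranspose_kronecker,
    ← Matrix.conjTranspose_kronecker, Matrix.sub_mulVec, Matrix.sub_mulVec, dotProduct_sub,
    dotProduct_sub, ← sqNorm_mulVec] at this
  have h2 := sqNorm_mulVec (C₂ ⊗ₖ Z 1)ᴴ q
  rw [Matrix.conjTranspose_conjTranspose] at h2
  rw [← h2, Matrix.one_mulVec, star_dotProduct_self, ← Complex.ofReal_sub, ← Complex.ofReal_sub,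
    Complex.zero_le_real] at this
  linarith

theorem posSemidef_kronecker {ι κ : Type*} [Fintype ι] [Fintype κ] [DecidableEq ι] [DecidableEq κ]
    {K : Matrix ι ι ℂ} {Y : Matrix κ κ ℂ} (hK : K.PosSemidef) (hY : Y.PosSemidef) :
    (K ⊗ₖ Y).PosSemidef :=
  Matrix.PosSemidef.kronecker hK hY

theorem sub_kronecker {ι ι' κ κ' : Type*} (K L : Matrix ι ι' ℂ) (Y : Matrix κ κ' ℂ) :
    (K - L) ⊗ₖ Y = K ⊗ₖ Y - L ⊗ₖ Y := by
  ext
  simp [sub_mul]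

theorem kronecker_sub {ι ι' κ κ' : Type*} (K : Matrix ι ι' ℂ) (Y W : Matrix κ κ' ℂ) :
    K ⊗ₖ (Y - W) = K ⊗ₖ Y - K ⊗ₖ W := by
  ext
  simp [mul_sub]

theorem mem_closedSpec_of_norm_le (hC : (1 - (C₁ᴴ * C₁ + C₂ * C₂ᴴ)).PosSemidef) {Z : Tuple 2 N}
    (h₀ : ‖Z 0‖ ≤ 1) (h₁ : ‖Z 1‖ ≤ 1) : Z ∈ closedSpec (blockPair C₁ C₂) N := by
  refine mem_closedSpec_of_posSemidef ?_
  have hA := posSemidef_kronecker (Matrix.posSemidef_conjTranspose_mul_self C₁)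
    (posSemidef_one_sub_conjTranspose_mul_self h₀)
  have h₁' : ‖(Z 1)ᴴ‖ ≤ 1 := by rwa [Matrix.l2_opNorm_conjTranspose]
  have hB := posSemidef_kronecker (Matrix.posSemidef_self_mul_conjTranspose C₂)
    (posSemidef_one_sub_conjTranspose_mul_self h₁')
  have hW := posSemidef_kronecker hC (Matrix.PosSemidef.one (n := Fin N) (R := ℂ))
  -- The defect is `(1 - C₁ᴴC₁ - C₂C₂ᴴ) ⊗ 1 + C₁ᴴC₁ ⊗ (1 - Z₀ᴴZ₀) + C₂C₂ᴴ ⊗ (1 - Z₁Z₁ᴴ)`.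
  convert (hW.add hA).add hB using 1
  simp only [sub_kronecker, Matrix.add_kronecker, kronecker_sub,
    Matrix.one_kronecker_one, Matrix.conjTranspose_conjTranspose]
  abel

/-- A norm inequality for Kronecker products of contractions. -/
theorem sqNorm_kronecker_mulVec_le {ι κ ι' κ' : Type*} [Fintype ι] [Fintype κ] [Fintype ι']
    [Fintype κ'] [DecidableEq ι] [DecidableEq κ] {C : Matrix ι' ι ℂ} {Z : Matrix κ' κ ℂ}
    (hC : ‖C‖ ≤ 1) (hZ : ‖Z‖ ≤ 1) (q : ι × κ → ℂ) : sqNorm ((C ⊗ₖ Z) *ᵥ q) ≤ sqNorm q := by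
  have hA := posSemidef_kronecker (Matrix.posSemidef_conjTranspose_mul_self C)
    (posSemidef_one_sub_conjTranspose_mul_self hZ)
  have hW := posSemidef_kronecker (posSemidef_one_sub_conjTranspose_mul_self hC)
    (Matrix.PosSemidef.one (n := κ) (R := ℂ))
  have h : (1 - (C ⊗ₖ Z)ᴴ * (C ⊗ₖ Z)).PosSemidef := by
    convert hA.add hW using 1
    simp only [sub_kronecker, kronecker_sub, Matrix.one_kronecker_one,
      Matrix.conjTranspose_kronecker, Matrix.mul_kronecker_mul]
    abel
  have := h.dotProduct_mulVec_nonneg q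
  rw [Matrix.sub_mulVec, dotProduct_sub, ← sqNorm_mulVec, Matrix.one_mulVec, star_dotProduct_self,
    ← Complex.ofReal_sub, Complex.zero_le_real] at this
  linarith

theorem mem_interiorSpec_of_norm_le (hC₁ : ‖C₁‖ = 1) (hC₂ : ‖C₂‖ = 1) {X : Tuple 2 N}
    (h : ‖X‖ ≤ 1 / 2) : X ∈ interiorSpec (blockPair C₁ C₂) N := by
  have hX : X = (1 / 2 : ℂ) • ((2 : ℂ) • X) := by simp [smul_smul]
  have h2 : ∀ j, ‖((2 : ℂ) • X) j‖ ≤ 1 := fun j => by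
    have := norm_le_pi_norm X j
    rw [Pi.smul_apply, norm_smul]
    norm_num
    linarith
  refine mem_interiorSpec_iff.2 fun q hq => ?_
  have e1 := sqNorm_kronecker_mulVec_le hC₁.le (h2 0) q
  have e2 := sqNorm_kronecker_mulVec_le (C₂.l2_opNorm_conjTranspose.trans hC₂).le
    (((((2 : ℂ) • X) 1).l2_opNorm_conjTranspose).le.trans (h2 1)) q
  rw [← Matrix.conjTranspose_kronecker] at e2
  rw [Pi.smul_apply, Matrix.kronecker_smul, Matrix.smul_mulVec, sqNorm_smul] at e1
  rw [Pi.smul_apply, Matrix.kronecker_smul, Matrix.conjTranspose_smul, Matrix.smul_mulVec,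
    sqNorm_smul, norm_star] at e2
  norm_num at e1 e2
  linarith [sqNorm_pos hq]

theorem interiorSpec_mem_nhds_zero (hC₁ : ‖C₁‖ = 1) (hC₂ : ‖C₂‖ = 1) :
    interiorSpec (blockPair C₁ C₂) N ∈ nhds 0 :=
  Filter.mem_of_superset (Metric.closedBall_mem_nhds 0 (by norm_num : (0 : ℝ) < 1 / 2))
    fun _ hX => mem_interiorSpec_of_norm_le hC₁ hC₂ (by simpa using hX)

theorem zero_mem_interiorSpec (hC₁ : ‖C₁‖ = 1) (hC₂ : ‖C₂‖ = 1) :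
    (0 : Tuple 2 N) ∈ interiorSpec (blockPair C₁ C₂) N :=
  mem_of_mem_nhds (interiorSpec_mem_nhds_zero hC₁ hC₂)

theorem isClosed_closedSpec : IsClosed (closedSpec (blockPair C₁ C₂) N) := by
  have : closedSpec (blockPair C₁ C₂) N = ⋂ q, {X : Tuple 2 N |
      sqNorm ((C₁ ⊗ₖ X 0) *ᵥ q) + sqNorm ((C₂ ⊗ₖ X 1)ᴴ *ᵥ q) ≤ sqNorm q} := by
    ext X
    simp [mem_closedSpec_iff]
  rw [this]
  refine isClosed_iInter fun q => isClosed_le ?_ continuous_const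
  simp only [sqNorm, Matrix.mulVec, dotProduct, Matrix.kroneckerMap_apply,
    Matrix.conjTranspose_apply]
  have h : ∀ (j : Fin 2) (a b : Fin N), Continuous fun X : Tuple 2 N => X j a b := fun j a b =>
    (continuous_apply b).comp ((continuous_apply a).comp (continuous_apply j))
  fun_prop

theorem interiorSpec_eq_freeBidisk (hC₁ : ‖C₁‖ = 1) (hC₂ : ‖C₂‖ = 1)
    (hC : (1 - (C₁ᴴ * C₁ + C₂ * C₂ᴴ)).PosSemidef) :
    interiorSpec (blockPair C₁ C₂) N = freeBidisk N := by
  refine (interiorSpec_subset_freeBidisk hC₁ hC₂).antisymm fun X hX => ?_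
  -- Dividing by `c` keeps both norms at most one, so `X` is a strict multiple of a point of the
  -- closed spectrahedron.
  obtain ⟨c, hc, hc1⟩ : ∃ c : ℝ, max ‖X 0‖ ‖X 1‖ < c ∧ c < 1 :=
    exists_between (max_lt (hX 0) (hX 1))
  have hc0 : 0 < c := (norm_nonneg _).trans_lt ((le_max_left _ _).trans_lt hc)
  have hcC : (c : ℂ) ≠ 0 := by exact_mod_cast hc0.ne'
  have hXc : X = (c : ℂ) • ((c : ℂ)⁻¹ • X) := by rw [smul_smul, mul_inv_cancel₀ hcC, one_smul]
  have hle : ∀ j, ‖X j‖ ≤ c → ‖((c : ℂ)⁻¹ • X) j‖ ≤ 1 := fun j hj => by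
    rw [Pi.smul_apply, norm_smul, norm_inv, Complex.norm_real, Real.norm_eq_abs, abs_of_pos hc0,
      inv_mul_le_one₀ hc0]
    exact hj
  rw [hXc]
  refine smul_mem_interiorSpec (mem_closedSpec_of_norm_le hC (hle 0 ?_) (hle 1 ?_)) ?_
  · exact (le_max_left _ _).trans hc.le
  · exact (le_max_right _ _).trans hc.le
  · rwa [Complex.norm_real, Real.norm_eq_abs, abs_of_pos hc0]

end Membership

/-! ### Linear free maps -/

section FreeMaps

open Filter Topology Metric

variable {g N M : ℕ}

/-- `directSum` as a linear map. -/
def directSumₗ (g n m : ℕ) : (Tuple g n × Tuple g m) →ₗ[ℂ] Tuple g (n + m) where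
  toFun p := directSum p.1 p.2
  map_add' p q := by
    ext j a c
    refine Fin.addCases (fun a' => ?_) (fun a' => ?_) a <;>
    refine Fin.addCases (fun c' => ?_) (fun c' => ?_) c <;> simp [directSum]
  map_smul' t p := by
    ext j a c
    refine Fin.addCases (fun a' => ?_) (fun a' => ?_) a <;>
    refine Fin.addCases (fun c' => ?_) (fun c' => ?_) c <;> simp [directSum]

theorem directSum_smul {n m : ℕ} (t : ℂ) (X : Tuple g n) (Y : Tuple g m) :
    t • directSum X Y = directSum (t • X) (t • Y) :=
  ((directSumₗ g n m).map_smul t (X, Y)).symm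

/-- `conj U` as a linear map. -/
def conjₗ (g : ℕ) {n : ℕ} (U : Matrix (Fin n) (Fin n) ℂ) : Tuple g n →ₗ[ℂ] Tuple g n where
  toFun X := conj U X
  map_add' X Y := by
    ext1 j
    simp [conj, mul_add, add_mul]
  map_smul' t X := by
    ext1 j
    simp [conj]

/-- The entries of a tuple as linear functionals. -/
def entryₗ {n : ℕ} (j : Fin g) (a c : Fin n) : Tuple g n →ₗ[ℂ] ℂ where
  toFun X := X j a c
  map_add' _ _ := rfl
  map_smul' _ _ := rfl

/-- The linear map on tuples given by a scalar matrix of coefficients. -/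
def coeffMap {g : ℕ} (K : Matrix (Fin g) (Fin g) ℂ) (n : ℕ) : Tuple g n →ₗ[ℂ] Tuple g n where
  toFun X := fun i => ∑ j, K i j • X j
  map_add' X Y := by
    ext1 i
    simp [Finset.sum_add_distrib]
  map_smul' t X := by
    ext1 i
    simp [Finset.smul_sum, smul_comm t]

theorem coeffMap_directSum (K : Matrix (Fin g) (Fin g) ℂ) {n m : ℕ} (X : Tuple g n)
    (Y : Tuple g m) :
    coeffMap K (n + m) (directSum X Y) = directSum (coeffMap K n X) (coeffMap K m Y) := by
  ext j a c
  refine Fin.addCases (fun a' => ?_) (fun a' => ?_) a <;>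
  refine Fin.addCases (fun c' => ?_) (fun c' => ?_) c <;>
  simp [coeffMap, directSum, Matrix.sum_apply]

theorem coeffMap_conj (K : Matrix (Fin g) (Fin g) ℂ) {n : ℕ} (U : Matrix (Fin n) (Fin n) ℂ)
    (X : Tuple g n) : coeffMap K n (conj U X) = conj U (coeffMap K n X) := by
  ext1 i
  simp [coeffMap, conj, Finset.mul_sum, Finset.sum_mul]

theorem tuple_diagonal_succ (d : Fin g → Fin (N + 1) → ℂ) :
    (fun j => Matrix.diagonal (d j) : Tuple g (N + 1)) =
      directSum (fun j => Matrix.diagonal fun a => d j a.castSucc)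
        (fun j => Matrix.diagonal fun _ => d j (Fin.last N)) := by
  ext j a c
  refine Fin.addCases (fun a' => ?_) (fun a' => ?_) a <;>
  refine Fin.addCases (fun c' => ?_) (fun c' => ?_) c
  · have : (Fin.castAdd 1 a' = Fin.castAdd 1 c') ↔ a' = c' := by simp [Fin.ext_iff]
    simp only [directSum, Matrix.reindex_apply, Matrix.submatrix_apply,
      finSumFinEquiv_symm_apply_castAdd, Matrix.fromBlocks_apply₁₁, Matrix.diagonal_apply, this]
    rfl
  · have : Fin.castAdd 1 a' ≠ Fin.natAdd N c' := by
      simp [Fin.ext_iff]; omega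
    simp [directSum, this]
  · have : Fin.natAdd N a' ≠ Fin.castAdd 1 c' := by
      simp [Fin.ext_iff]; omega
    simp [directSum, this]
  · have ha : a' = 0 := Subsingleton.elim _ _
    have hc : c' = 0 := Subsingleton.elim _ _
    subst ha hc
    simp [directSum]
    rfl

/-- A family of linear maps compatible with direct sums and unitary conjugations is given by a
matrix of coefficients. -/
theorem eq_coeffMap (T : ∀ n, Tuple g n →ₗ[ℂ] Tuple g n)
    (hds : ∀ n m (X : Tuple g n) (Y : Tuple g m),
      T (n + m) (directSum X Y) = directSum (T n X) (T m Y))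
    (hconj : ∀ n (X : Tuple g n), ∀ U ∈ Matrix.unitaryGroup (Fin n) ℂ,
      T n (conj U X) = conj U (T n X)) (n : ℕ) :
    T n = coeffMap (fun i j => T 1 (Pi.single j 1) i 0 0) n := by
  set K : Matrix (Fin g) (Fin g) ℂ := fun i j => T 1 (Pi.single j 1) i 0 0 with hK
  have h1 : T 1 = coeffMap K 1 := by
    refine LinearMap.ext fun X => ?_
    have hX : X = ∑ j, X j 0 0 • (Pi.single j 1 : Tuple g 1) := by
      ext j a c
      rw [Subsingleton.elim a 0, Subsingleton.elim c 0, Finset.sum_apply, Matrix.sum_apply,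
        Finset.sum_eq_single j]
      · simp
      · intro b _ hb
        simp [Pi.single_eq_of_ne hb.symm]
      · simp
    conv_lhs => rw [hX]
    rw [map_sum]
    ext i a c
    rw [Subsingleton.elim a 0, Subsingleton.elim c 0, Finset.sum_apply, Matrix.sum_apply]
    simp [coeffMap, hK, Matrix.sum_apply, mul_comm]
  -- Diagonal tuples are direct sums of scalars. The spectral theorem then handles a Hermitian
  -- matrix in one coordinate, and real and imaginary parts handle the rest.
  have hdiag : ∀ (n : ℕ) (d : Fin g → Fin n → ℂ),
      T n (fun j => Matrix.diagonal (d j)) = coeffMap K n (fun j => Matrix.diagonal (d j)) := by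
    intro n
    induction n with
    | zero => intro d; ext j a; exact a.elim0
    | succ n ih =>
      intro d
      rw [tuple_diagonal_succ, hds, coeffMap_directSum, ih, h1]
  have hherm : ∀ (j : Fin g) (H : Matrix (Fin n) (Fin n) ℂ), H.IsHermitian →
      T n (Pi.single j H) = coeffMap K n (Pi.single j H) := by
    intro j H hH
    have hU : ((hH.eigenvectorUnitary : Matrix (Fin n) (Fin n) ℂ))ᴴ ∈
        Matrix.unitaryGroup (Fin n) ℂ := Unitary.star_mem hH.eigenvectorUnitary.2
    have hsp := hH.spectral_theorem
    set d : Fin n → ℂ := RCLike.ofReal ∘ hH.eigenvalues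
    have hrep : (Pi.single j H : Tuple g n) =
        conj ((hH.eigenvectorUnitary : Matrix (Fin n) (Fin n) ℂ))ᴴ
          (fun l => Matrix.diagonal ((Pi.single j d : Fin g → Fin n → ℂ) l)) := by
      ext1 l
      rcases eq_or_ne l j with rfl | hl
      · simp only [Pi.single_eq_same, conj, Matrix.conjTranspose_conjTranspose]
        exact hsp.trans (Unitary.conjStarAlgAut_apply _ _)
      · simp [Pi.single_eq_of_ne hl, conj]
    rw [hrep, hconj _ _ _ hU, hdiag, coeffMap_conj]
  refine LinearMap.pi_ext fun j Y => ?_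
  have hY : (Pi.single j Y : Tuple g n) =
      Pi.single j ((realPart Y : Matrix (Fin n) (Fin n) ℂ)) +
        Complex.I • (Pi.single j ((imaginaryPart Y : Matrix (Fin n) (Fin n) ℂ)) : Tuple g n) := by
    conv_lhs => rw [← realPart_add_I_smul_imaginaryPart Y]
    rw [Pi.single_add, Pi.single_smul]
  rw [hY, map_add, map_add, map_smul, map_smul, hherm _ _ (realPart Y).2,
    hherm _ _ (imaginaryPart Y).2]

end FreeMaps

/-! ### Value and derivative at the origin -/

section FreeAutomorphisms

open Filter Topology Metric

variable {k m n : ℕ} {C₁ : Matrix (Fin k) (Fin m) ℂ} {C₂ : Matrix (Fin m) (Fin n) ℂ}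
  {φ : ∀ N, Tuple 2 N → Tuple 2 N}

/-- The value of a free map at the origin. -/
def originValue (φ : ∀ N, Tuple 2 N → Tuple 2 N) : Fin 2 → ℂ := fun j => φ 1 0 j 0 0

/-- The derivative of a free map at the origin of level one. -/
def originDeriv (φ : ∀ N, Tuple 2 N → Tuple 2 N) : Matrix (Fin 2) (Fin 2) ℂ :=
  fun i j => fderiv ℂ (φ 1) 0 (Pi.single j 1) i 0 0

theorem map_zero_eq (hC₁ : ‖C₁‖ = 1) (hC₂ : ‖C₂‖ = 1)
    (hφ : IsFreeAnalytic (blockPair C₁ C₂) (blockPair C₁ C₂) φ) (N : ℕ) :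
    φ N 0 = fun j => Matrix.diagonal fun _ => originValue φ j := by
  induction N with
  | zero => ext j a; exact a.elim0
  | succ N ih =>
    have h0 : (0 : Tuple 2 (N + 1)) = directSum (0 : Tuple 2 N) (0 : Tuple 2 1) :=
      ((directSumₗ 2 N 1).map_zero).symm
    rw [h0, hφ.map_directSum N 1 _ (zero_mem_interiorSpec hC₁ hC₂) _
      (zero_mem_interiorSpec hC₁ hC₂), ih, tuple_diagonal_succ]
    congr 1
    ext j a c
    rw [Subsingleton.elim a 0, Subsingleton.elim c 0]
    simp [originValue]

theorem hasDerivAt_line (hC₁ : ‖C₁‖ = 1) (hC₂ : ‖C₂‖ = 1)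
    (hφ : IsFreeAnalytic (blockPair C₁ C₂) (blockPair C₁ C₂) φ) {N : ℕ} (X : Tuple 2 N) :
    HasDerivAt (fun t : ℂ => φ N (t • X)) (fderiv ℂ (φ N) 0 X) 0 := by
  have h1 : HasFDerivAt (φ N) (fderiv ℂ (φ N) 0) ((0 : ℂ) • X) := by
    rw [zero_smul]
    exact (hφ.analytic N 0 (zero_mem_interiorSpec hC₁ hC₂)).differentiableAt.hasFDerivAt
  have h2 : HasDerivAt (fun t : ℂ => t • X) X 0 := by
    simpa using (hasDerivAt_id (0 : ℂ)).smul_const X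
  exact h1.comp_hasDerivAt 0 h2

theorem eventually_smul_mem (hC₁ : ‖C₁‖ = 1) (hC₂ : ‖C₂‖ = 1) {N : ℕ} (X : Tuple 2 N) :
    ∀ᶠ t : ℂ in 𝓝 0, t • X ∈ interiorSpec (blockPair C₁ C₂) N := by
  have hc : Continuous fun t : ℂ => t • X := by fun_prop
  exact hc.continuousAt (x := 0) (by
    rw [zero_smul]; exact interiorSpec_mem_nhds_zero hC₁ hC₂)

/-- Differentiating the direct sum and conjugation identities along `t • X` at `t = 0` shows that
the derivatives form a linear free map. -/
theorem fderiv_zero_eq_coeffMap (hC₁ : ‖C₁‖ = 1) (hC₂ : ‖C₂‖ = 1)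
    (hφ : IsFreeAnalytic (blockPair C₁ C₂) (blockPair C₁ C₂) φ) (N : ℕ) (X : Tuple 2 N) :
    fderiv ℂ (φ N) 0 X = coeffMap (originDeriv φ) N X := by
  refine LinearMap.congr_fun (eq_coeffMap
    (fun N => (fderiv ℂ (φ N) 0 : Tuple 2 N →ₗ[ℂ] Tuple 2 N)) ?_ ?_ N) X
  · intro n m X Y
    have h1 := hasDerivAt_line hC₁ hC₂ hφ (directSum X Y)
    have h2 := ((directSumₗ 2 n m).toContinuousLinearMap.hasFDerivAt.comp_hasDerivAt (0 : ℂ)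
      ((hasDerivAt_line hC₁ hC₂ hφ X).prodMk (hasDerivAt_line hC₁ hC₂ hφ Y)))
    refine h1.unique (h2.congr_of_eventuallyEq ?_)
    filter_upwards [eventually_smul_mem hC₁ hC₂ X, eventually_smul_mem hC₁ hC₂ Y] with t hX hY
    rw [directSum_smul, hφ.map_directSum _ _ _ hX _ hY]
    rfl
  · intro n X U hU
    have h1 := hasDerivAt_line hC₁ hC₂ hφ (conj U X)
    have h2 := ((conjₗ 2 U).toContinuousLinearMap.hasFDerivAt.comp_hasDerivAt (0 : ℂ)
      (hasDerivAt_line hC₁ hC₂ hφ X))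
    refine h1.unique (h2.congr_of_eventuallyEq ?_)
    filter_upwards [eventually_smul_mem hC₁ hC₂ X] with t hX
    have : t • conj U X = conj U (t • X) := ((conjₗ 2 U).map_smul t X).symm
    rw [this, hφ.map_conj _ _ hX _ hU]
    rfl

end FreeAutomorphisms

/-! ### Boundary values along superdiagonal tuples -/

section Graded

open Filter Topology Metric

variable {k m n N : ℕ} {C₁ : Matrix (Fin k) (Fin m) ℂ} {C₂ : Matrix (Fin m) (Fin n) ℂ}
  {φ : ∀ N, Tuple 2 N → Tuple 2 N}

/-- The diagonal matrix with entries `1, u, u ^ 2, …`. -/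
def gradingMatrix (u : ℂ) (N : ℕ) : Matrix (Fin N) (Fin N) ℂ :=
  Matrix.diagonal fun a => u ^ (a : ℕ)

theorem star_mul_self_of_norm_eq_one {u : ℂ} (hu : ‖u‖ = 1) : star u * u = 1 := by
  simp [Complex.conj_mul', hu]

theorem gradingMatrix_mem_unitaryGroup {u : ℂ} (hu : ‖u‖ = 1) :
    gradingMatrix u N ∈ Matrix.unitaryGroup (Fin N) ℂ := by
  rw [Matrix.mem_unitaryGroup_iff', Matrix.star_eq_conjTranspose, gradingMatrix,
    Matrix.diagonal_conjTranspose, Matrix.diagonal_mul_diagonal]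
  rw [← Matrix.diagonal_one]
  congr 1
  ext a
  rw [Pi.star_apply, star_pow, ← mul_pow, star_mul_self_of_norm_eq_one hu, one_pow]

theorem conj_gradingMatrix_apply (u : ℂ) (X : Tuple 2 N) (j : Fin 2) (a c : Fin N) :
    conj (gradingMatrix u N) X j a c = star u ^ (a : ℕ) * u ^ (c : ℕ) * X j a c := by
  simp only [conj, gradingMatrix, Matrix.diagonal_conjTranspose, Matrix.mul_diagonal,
    Matrix.diagonal_mul, Pi.star_apply, star_pow]
  ring

/-- A tuple of matrices supported on the first superdiagonal. -/
def IsSuperdiagonal (Z : Tuple 2 N) : Prop :=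
  ∀ j (a c : Fin N), (c : ℕ) ≠ a + 1 → Z j a c = 0

theorem IsSuperdiagonal.conj_gradingMatrix {Z : Tuple 2 N} (hZ : IsSuperdiagonal Z) {u : ℂ}
    (hu : ‖u‖ = 1) (t : ℂ) : conj (gradingMatrix u N) (t • Z) = (u * t) • Z := by
  ext j a c
  rw [conj_gradingMatrix_apply]
  by_cases h : (c : ℕ) = a + 1
  · have := star_mul_self_of_norm_eq_one hu
    rw [h, pow_succ, ← mul_assoc, ← mul_pow, this, one_pow, one_mul]
    simp [mul_assoc]
  · simp [hZ j a c h]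

/-- The limit of a free map along a superdiagonal tuple on the boundary: it is upper triangular, the
diagonal is the value at the origin and the superdiagonal is given by the derivative there. -/
structure IsBoundaryJet (φ : ∀ N, Tuple 2 N → Tuple 2 N) (Z Q : Tuple 2 N) : Prop where
  map_smul : ∀ t : ℂ, ‖t‖ < 1 → ∀ j a c, φ N (t • Z) j a c = t ^ ((c : ℕ) - a) * Q j a c
  lower : ∀ j (a c : Fin N), c < a → Q j a c = 0
  diag : ∀ j a, Q j a a = originValue φ j
  super : ∀ j (a c : Fin N), (c : ℕ) = a + 1 → Q j a c = ∑ l, originDeriv φ j l * Z l a c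

/-- By the grading, entry `(a, c)` of `φ(tZ)` has weight `c - a` under rotation of `t`. A negative
weight forces zero; a nonnegative one gives a monomial, whose coefficient is read off at `t = 0` for
weights zero and one. -/
theorem exists_isBoundaryJet (hC₁ : ‖C₁‖ = 1) (hC₂ : ‖C₂‖ = 1)
    (hφ : IsFreeAnalytic (blockPair C₁ C₂) (blockPair C₁ C₂) φ) {Z : Tuple 2 N}
    (hZ : IsSuperdiagonal Z) (hZc : Z ∈ closedSpec (blockPair C₁ C₂) N) :
    ∃ Q, IsBoundaryJet φ Z Q := by
  have hmem : ∀ t : ℂ, ‖t‖ < 1 → t • Z ∈ interiorSpec (blockPair C₁ C₂) N := fun t ht =>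
    smul_mem_interiorSpec hZc ht
  have hrot : ∀ u t : ℂ, ‖u‖ = 1 → ‖t‖ < 1 → ∀ j a c,
      φ N ((u * t) • Z) j a c = star u ^ (a : ℕ) * u ^ (c : ℕ) * φ N (t • Z) j a c := by
    intro u t hu ht j a c
    rw [← hZ.conj_gradingMatrix hu, hφ.map_conj N _ (hmem t ht) _
      (gradingMatrix_mem_unitaryGroup hu), conj_gradingMatrix_apply]
  have hdiff : ∀ j a c, DifferentiableOn ℂ (fun t : ℂ => φ N (t • Z) j a c) (ball 0 1) := by
    intro j a c t ht
    have h1 := (hφ.analytic N _ (hmem t (by simpa using ht))).differentiableAt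
    have h2 : DifferentiableAt ℂ (fun t : ℂ => t • Z) t := by fun_prop
    exact ((entryₗ j a c).toContinuousLinearMap.differentiableAt.comp t
      (h1.comp t h2)).differentiableWithinAt
  have key : ∀ j (a c : Fin N), ∃ q : ℂ, (∀ t : ℂ, ‖t‖ < 1 →
      φ N (t • Z) j a c = t ^ ((c : ℕ) - a) * q) ∧ (c < a → q = 0) := by
    intro j a c
    rcases le_or_gt a c with h | h
    · obtain ⟨q, hq⟩ := exists_eq_pow_smul (hdiff j a c) ((c : ℕ) - a) (by
        intro u t hu ht
        rw [hrot u t hu ht, smul_eq_mul]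
        congr 1
        have hac : (c : ℕ) = a + (c - a) := by have : (a : ℕ) ≤ c := h; omega
        conv_lhs => rw [hac, pow_add, ← mul_assoc, ← mul_pow, star_mul_self_of_norm_eq_one hu]
        simp)
      exact ⟨q, hq, fun h' => absurd h' (not_lt.2 h)⟩
    · refine ⟨0, fun t ht => ?_, fun _ => rfl⟩
      have hlt : (c : ℕ) < a := h
      rw [mul_zero]
      refine eq_zero_of_pow_smul_eq (hdiff j a c) (p := (a : ℕ) - c) (by omega) ?_ ht
      intro u t hu ht
      have hac : (a : ℕ) = c + (a - c) := by omega
      rw [hrot u t hu ht, smul_eq_mul, ← mul_assoc]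
      have : u ^ ((a : ℕ) - c) * (star u ^ (a : ℕ) * u ^ (c : ℕ)) = 1 := by
        conv_lhs => rw [hac]
        rw [show (c : ℕ) + (a - c) - c = a - c by omega,
          show u ^ ((a : ℕ) - c) * (star u ^ ((c : ℕ) + (a - c)) * u ^ (c : ℕ)) =
            (star u * u) ^ ((c : ℕ) + (a - c)) by rw [mul_pow, pow_add u]; ring,
          star_mul_self_of_norm_eq_one hu, one_pow]
      rw [this, one_mul]
  choose Q hQ hQ0 using key
  refine ⟨Q, fun t ht j a c => hQ j a c t ht, fun j a c h => hQ0 j a c h, ?_, ?_⟩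
  · intro j a
    have := hQ j a a 0 (by simp)
    rw [zero_smul, map_zero_eq hC₁ hC₂ hφ] at this
    simpa using this.symm
  · intro j a c h
    have h1 := (entryₗ j a c).toContinuousLinearMap.hasFDerivAt.comp_hasDerivAt (0 : ℂ)
      (hasDerivAt_line hC₁ hC₂ hφ Z)
    have h2 : HasDerivAt (fun t : ℂ => t * Q j a c) (Q j a c) 0 := by
      simpa using (hasDerivAt_id (0 : ℂ)).mul_const (Q j a c)
    have h3 := h2.congr_of_eventuallyEq (f₁ := fun t : ℂ => φ N (t • Z) j a c) (by
      filter_upwards [ball_mem_nhds (0 : ℂ) one_pos] with t ht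
      rw [hQ j a c t (by simpa using ht), h]
      simp)
    rw [h3.unique h1, fderiv_zero_eq_coeffMap hC₁ hC₂ hφ]
    change (∑ l, originDeriv φ j l • Z l) a c = _
    simp [Matrix.sum_apply]

theorem IsBoundaryJet.tendsto {Z Q : Tuple 2 N} (hQ : IsBoundaryJet φ Z Q) :
    Tendsto (fun t : ℂ => φ N (t • Z)) (𝓝[ball 0 1] 1) (𝓝 Q) := by
  refine tendsto_pi_nhds.2 fun j => tendsto_pi_nhds.2 fun a => tendsto_pi_nhds.2 fun c => ?_
  have h : Tendsto (fun t : ℂ => t ^ ((c : ℕ) - a) * Q j a c) (𝓝[ball 0 1] 1) (𝓝 (Q j a c)) := by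
    have hc : Continuous fun t : ℂ => t ^ ((c : ℕ) - a) * Q j a c := by fun_prop
    simpa using (hc.tendsto 1).mono_left nhdsWithin_le_nhds
  refine h.congr' ?_
  filter_upwards [self_mem_nhdsWithin] with t ht
  exact (hQ.map_smul t (by simpa using ht) j a c).symm

theorem nhdsWithin_ball_one_neBot : (𝓝[ball 0 1] (1 : ℂ)).NeBot := by
  rw [← mem_closure_iff_nhdsWithin_neBot, closure_ball _ one_ne_zero]
  simp

theorem IsBoundaryJet.mem_closedSpec (hφ : IsFreeAnalytic (blockPair C₁ C₂) (blockPair C₁ C₂) φ)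
    {Z Q : Tuple 2 N} (hZc : Z ∈ closedSpec (blockPair C₁ C₂) N) (hQ : IsBoundaryJet φ Z Q) :
    Q ∈ closedSpec (blockPair C₁ C₂) N := by
  have := nhdsWithin_ball_one_neBot
  refine isClosed_closedSpec.mem_of_tendsto hQ.tendsto ?_
  filter_upwards [self_mem_nhdsWithin] with t ht
  exact interiorSpec_subset_closedSpec
    (hφ.mapsTo N (smul_mem_interiorSpec hZc (by simpa using ht)))

/-- Were `Q` interior, continuity of the inverse at `Q` would send the limit of `φ(tZ)` back to `Z`
and make `Z` interior. -/
theorem IsBoundaryJet.notMem_interiorSpec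
    (hφ : IsFreeBianalytic (blockPair C₁ C₂) (blockPair C₁ C₂) φ)
    {Z Q : Tuple 2 N} (hZc : Z ∈ closedSpec (blockPair C₁ C₂) N) (hQ : IsBoundaryJet φ Z Q)
    (hZ : Z ∉ interiorSpec (blockPair C₁ C₂) N) : Q ∉ interiorSpec (blockPair C₁ C₂) N := by
  intro hQi
  obtain ⟨hφ, ψ, hψ, hinv⟩ := hφ
  have := nhdsWithin_ball_one_neBot
  have h1 := ((hψ.analytic N Q hQi).continuousAt.tendsto).comp hQ.tendsto
  have h2 : Tendsto (fun t : ℂ => t • Z) (𝓝[ball 0 1] 1) (𝓝 Z) := by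
    have hc : Continuous fun t : ℂ => t • Z := by fun_prop
    simpa using (hc.tendsto 1).mono_left nhdsWithin_le_nhds
  have h3 : Tendsto (fun t : ℂ => t • Z) (𝓝[ball 0 1] 1) (𝓝 (ψ N Q)) := by
    refine h1.congr' ?_
    filter_upwards [self_mem_nhdsWithin] with t ht
    exact (hinv N).1 (smul_mem_interiorSpec hZc (by simpa using ht))
  rw [tendsto_nhds_unique h2 h3] at hZ
  exact hZ (hψ.mapsTo N hQi)

end Graded

/-! ### Kernels of affine families and contraction estimates -/

section Kernel

variable {ι κ : Type*} [Fintype ι] [Fintype κ]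

/-- The linear term `Re (c s)` has one sign for every direction of `c`, so `s = 0`. Then `x` is a
null vector of every member of the positive family, hence lies in all the kernels. -/
theorem mulVec_eq_zero_of_posSemidef {Φ K : Matrix ι ι ℂ}
    (h : ∀ c : ℂ, ‖c‖ ≤ 1 → (Φ - c • K - (c • K)ᴴ).PosSemidef) {x : ι → ℂ}
    (hx : star x ⬝ᵥ (Φ *ᵥ x) = 0) : Φ *ᵥ x = 0 ∧ K *ᵥ x = 0 ∧ Kᴴ *ᵥ x = 0 := by
  set s := star x ⬝ᵥ (K *ᵥ x) with hs
  have hs' : star x ⬝ᵥ (Kᴴ *ᵥ x) = star s := by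
    rw [hs, star_dotProduct_mulVec, Matrix.conjTranspose_conjTranspose, Matrix.star_dotProduct]
  have hform : ∀ c : ℂ, star x ⬝ᵥ ((Φ - c • K - (c • K)ᴴ) *ᵥ x) = -(c * s) - star c * star s := by
    intro c
    rw [Matrix.sub_mulVec, Matrix.sub_mulVec, dotProduct_sub, dotProduct_sub, hx,
      Matrix.conjTranspose_smul, Matrix.smul_mulVec, Matrix.smul_mulVec, dotProduct_smul,
      dotProduct_smul, hs', smul_eq_mul, smul_eq_mul, zero_sub]
  have hre : ∀ c : ℂ, ‖c‖ ≤ 1 → (c * s).re ≤ 0 := by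
    intro c hc
    have h1 := (h c hc).dotProduct_mulVec_nonneg x
    rw [hform, Complex.le_def] at h1
    have := h1.1
    simp at this
    simp
    linarith
  have e1 := hre 1 (by simp)
  have e2 := hre (-1) (by simp)
  have e3 := hre Complex.I (by simp)
  have e4 := hre (-Complex.I) (by simp)
  simp at e1 e2 e3 e4
  have hs0 : s = 0 := Complex.ext (le_antisymm e1 e2) (le_antisymm e4 e3)
  have hker : ∀ c : ℂ, ‖c‖ ≤ 1 → (Φ - c • K - (c • K)ᴴ) *ᵥ x = 0 := by
    intro c hc
    rw [← (h c hc).dotProduct_mulVec_zero_iff, hform, hs0]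
    simp
  have k0 : Φ *ᵥ x = 0 := by simpa using hker 0 (by simp)
  have k1 := hker 1 (by simp)
  have k2 := hker Complex.I (by simp)
  simp only [Matrix.sub_mulVec, k0, Matrix.conjTranspose_smul, Matrix.smul_mulVec, zero_sub,
    one_smul] at k1 k2
  have k1' : Kᴴ *ᵥ x = -(K *ᵥ x) := by
    rw [sub_eq_zero] at k1
    exact k1.symm
  have hK : K *ᵥ x = 0 := by
    rw [k1'] at k2
    have : (2 * Complex.I) • (K *ᵥ x) = 0 := by
      rw [← neg_eq_zero, ← k2]
      ext i
      simp
      ring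
    simpa using this
  exact ⟨k0, hK, by rw [k1', hK, neg_zero]⟩

/-- The Euclidean norm of a vector. -/
def vecNorm (v : ι → ℂ) : ℝ := ‖WithLp.toLp 2 v‖

theorem vecNorm_nonneg (v : ι → ℂ) : 0 ≤ vecNorm v := norm_nonneg _

theorem vecNorm_eq_zero {v : ι → ℂ} : vecNorm v = 0 ↔ v = 0 := by simp [vecNorm]

theorem vecNorm_add_le (u v : ι → ℂ) : vecNorm (u + v) ≤ vecNorm u + vecNorm v := by
  simpa [vecNorm] using norm_add_le (WithLp.toLp 2 u) (WithLp.toLp 2 v)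

theorem vecNorm_smul (c : ℂ) (v : ι → ℂ) : vecNorm (c • v) = ‖c‖ * vecNorm v := by
  simp [vecNorm, norm_smul]

theorem vecNorm_mulVec_le [DecidableEq κ] {K : Matrix ι κ ℂ} (hK : ‖K‖ ≤ 1) (v : κ → ℂ) :
    vecNorm (K *ᵥ v) ≤ vecNorm v :=
  (K.l2_opNorm_mulVec (WithLp.toLp 2 v)).trans (mul_le_of_le_one_left (norm_nonneg _) hK)

/-- Each vector has norm at most `‖b‖` times that of the other. -/
theorem eq_zero_of_eq_smul_mulVec [DecidableEq ι] [DecidableEq κ] {K : Matrix ι κ ℂ}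
    (hK : ‖K‖ ≤ 1) {b : ℂ} (hb : ‖b‖ < 1)
    {u : ι → ℂ} {v : κ → ℂ} (hu : u = b • (K *ᵥ v)) (hv : v = star b • (Kᴴ *ᵥ u)) :
    u = 0 ∧ v = 0 := by
  have h1 : vecNorm u ≤ ‖b‖ * vecNorm v := by
    conv_lhs => rw [hu, vecNorm_smul]
    exact mul_le_mul_of_nonneg_left (vecNorm_mulVec_le hK v) (norm_nonneg _)
  have h2 : vecNorm v ≤ ‖b‖ * vecNorm u := by
    conv_lhs => rw [hv, vecNorm_smul, norm_star]
    exact mul_le_mul_of_nonneg_left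
      (vecNorm_mulVec_le (K.l2_opNorm_conjTranspose.le.trans hK) u) (norm_nonneg _)
  have h3 : vecNorm u + vecNorm v = 0 := by
    nlinarith [vecNorm_nonneg u, vecNorm_nonneg v]
  exact ⟨vecNorm_eq_zero.1 (by linarith [vecNorm_nonneg u, vecNorm_nonneg v]),
    vecNorm_eq_zero.1 (by linarith [vecNorm_nonneg u, vecNorm_nonneg v])⟩

/-- Eliminating `w'` and `z'` and adding the norm estimates gives `(1 - ‖b‖² - ‖c‖)(‖z‖ + ‖w‖) ≤ 0`.
-/
theorem eq_zero_of_norm_lt_one_sub [DecidableEq ι] [DecidableEq κ] {K : Matrix ι κ ℂ}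
    (hK : ‖K‖ ≤ 1) {b c : ℂ}
    (hc : ‖c‖ < 1 - ‖b‖ ^ 2) {z z' : ι → ℂ} {w w' : κ → ℂ}
    (hz : z = b • (K *ᵥ w') + c • (K *ᵥ w)) (hw' : w' = star b • (Kᴴ *ᵥ z))
    (hw : w = star c • (Kᴴ *ᵥ z) + star b • (Kᴴ *ᵥ z')) (hz' : z' = b • (K *ᵥ w)) :
    z = 0 ∧ w = 0 := by
  have hK' : ‖Kᴴ‖ ≤ 1 := K.l2_opNorm_conjTranspose.le.trans hK
  have hb0 := norm_nonneg b
  have hc0 := norm_nonneg c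
  have e1 : vecNorm w' ≤ ‖b‖ * vecNorm z := by
    rw [hw', vecNorm_smul, norm_star]
    exact mul_le_mul_of_nonneg_left (vecNorm_mulVec_le hK' z) hb0
  have e2 : vecNorm z' ≤ ‖b‖ * vecNorm w := by
    rw [hz', vecNorm_smul]
    exact mul_le_mul_of_nonneg_left (vecNorm_mulVec_le hK w) hb0
  have e3 : vecNorm z ≤ ‖b‖ * vecNorm w' + ‖c‖ * vecNorm w := by
    conv_lhs => rw [hz]
    refine (vecNorm_add_le _ _).trans (add_le_add ?_ ?_)
    · rw [vecNorm_smul]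
      exact mul_le_mul_of_nonneg_left (vecNorm_mulVec_le hK _) hb0
    · rw [vecNorm_smul]
      exact mul_le_mul_of_nonneg_left (vecNorm_mulVec_le hK _) hc0
  have e4 : vecNorm w ≤ ‖c‖ * vecNorm z + ‖b‖ * vecNorm z' := by
    conv_lhs => rw [hw]
    refine (vecNorm_add_le _ _).trans (add_le_add ?_ ?_)
    · rw [vecNorm_smul, norm_star]
      exact mul_le_mul_of_nonneg_left (vecNorm_mulVec_le hK' _) hc0
    · rw [vecNorm_smul, norm_star]
      exact mul_le_mul_of_nonneg_left (vecNorm_mulVec_le hK' _) hb0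
  have e5 := mul_le_mul_of_nonneg_left e1 hb0
  have e6 := mul_le_mul_of_nonneg_left e2 hb0
  have hnz := vecNorm_nonneg z
  have hnw := vecNorm_nonneg w
  have e7 : (1 - ‖b‖ ^ 2 - ‖c‖) * (vecNorm z + vecNorm w) ≤ 0 := by nlinarith
  have e8 : vecNorm z + vecNorm w ≤ 0 := by
    by_contra hcon
    push Not at hcon
    nlinarith
  exact ⟨vecNorm_eq_zero.1 (by linarith), vecNorm_eq_zero.1 (by linarith)⟩

end Kernel

/-! ### Solving the kernel equations of a size-two jet -/

section JetKernel

variable {k m n : ℕ} {C₁ : Matrix (Fin k) (Fin m) ℂ} {C₂ : Matrix (Fin m) (Fin n) ℂ}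

/-- The equations for a vector, with blocks `z₁, w₁, z₂, w₂, z₃, w₃`, in the kernel of the pencil at
the pair of matrices with diagonal entries `b` and upper right entries `c`, and in the kernels of
the pencil and its adjoint at the pair with upper right entries `l`. -/
structure JetKernel (C₁ : Matrix (Fin k) (Fin m) ℂ) (C₂ : Matrix (Fin m) (Fin n) ℂ)
    (b c l : Fin 2 → ℂ) (z₁ w₁ : Fin k → ℂ) (z₂ w₂ : Fin m → ℂ) (z₃ w₃ : Fin n → ℂ) : Prop where
  hz₁ : z₁ = b 0 • (C₁ *ᵥ z₂) + c 0 • (C₁ *ᵥ w₂)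
  hw₁ : w₁ = b 0 • (C₁ *ᵥ w₂)
  hz₂ : z₂ = star (b 0) • (C₁ᴴ *ᵥ z₁) + (b 1 • (C₂ *ᵥ z₃) + c 1 • (C₂ *ᵥ w₃))
  hw₂ : w₂ = (star (c 0) • (C₁ᴴ *ᵥ z₁) + star (b 0) • (C₁ᴴ *ᵥ w₁)) + b 1 • (C₂ *ᵥ w₃)
  hz₃ : z₃ = star (b 1) • (C₂ᴴ *ᵥ z₂)
  hw₃ : w₃ = star (c 1) • (C₂ᴴ *ᵥ z₂) + star (b 1) • (C₂ᴴ *ᵥ w₂)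
  hl₁ : l 0 • (C₁ *ᵥ w₂) = 0
  hl₂ : l 1 • (C₂ *ᵥ w₃) = 0
  hl₁' : star (l 0) • (C₁ᴴ *ᵥ z₁) = 0
  hl₂' : star (l 1) • (C₂ᴴ *ᵥ z₂) = 0

namespace JetKernel

variable {b c l : Fin 2 → ℂ} {z₁ w₁ : Fin k → ℂ} {z₂ w₂ : Fin m → ℂ} {z₃ w₃ : Fin n → ℂ}

theorem first_zero (h : JetKernel C₁ C₂ b c l z₁ w₁ z₂ w₂ z₃ w₃) (hl : l 0 ≠ 0) :
    C₁ *ᵥ w₂ = 0 ∧ C₁ᴴ *ᵥ z₁ = 0 :=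
  ⟨(smul_eq_zero.1 h.hl₁).resolve_left hl,
    (smul_eq_zero.1 h.hl₁').resolve_left (star_ne_zero.2 hl)⟩

theorem second_zero (h : JetKernel C₁ C₂ b c l z₁ w₁ z₂ w₂ z₃ w₃) (hl : l 1 ≠ 0) :
    C₂ *ᵥ w₃ = 0 ∧ C₂ᴴ *ᵥ z₂ = 0 :=
  ⟨(smul_eq_zero.1 h.hl₂).resolve_left hl,
    (smul_eq_zero.1 h.hl₂').resolve_left (star_ne_zero.2 hl)⟩

theorem eq_zero_of_ne_of_ne (h : JetKernel C₁ C₂ b c l z₁ w₁ z₂ w₂ z₃ w₃) (hl₀ : l 0 ≠ 0)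
    (hl₁ : l 1 ≠ 0) : z₁ = 0 ∧ w₁ = 0 ∧ z₂ = 0 ∧ w₂ = 0 ∧ z₃ = 0 ∧ w₃ = 0 := by
  obtain ⟨a1, a2⟩ := h.first_zero hl₀
  obtain ⟨a3, a4⟩ := h.second_zero hl₁
  have w1 : w₁ = 0 := by rw [h.hw₁, a1, smul_zero]
  have w2 : w₂ = 0 := by rw [h.hw₂, a2, a3, w1]; simp
  have w3 : w₃ = 0 := by rw [h.hw₃, a4, w2]; simp
  have z3 : z₃ = 0 := by rw [h.hz₃, a4, smul_zero]
  have z2 : z₂ = 0 := by rw [h.hz₂, a2, a3, z3]; simp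
  have z1 : z₁ = 0 := by rw [h.hz₁, a1, z2]; simp
  exact ⟨z1, w1, z2, w2, z3, w3⟩

/-- A nonzero `l 0` removes the `C₁` terms from the middle equations; with `c 1 = 0` the pairs `(w₂,
w₃)` and `(z₂, z₃)` then decouple, each closing up with factor `b 1`. -/
theorem eq_zero_of_first_ne (hC₂ : ‖C₂‖ = 1) (hb : ‖b 1‖ < 1)
    (h : JetKernel C₁ C₂ b c l z₁ w₁ z₂ w₂ z₃ w₃) (hl : l 0 ≠ 0) (hc : c 1 = 0) :
    z₁ = 0 ∧ w₁ = 0 ∧ z₂ = 0 ∧ w₂ = 0 ∧ z₃ = 0 ∧ w₃ = 0 := by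
  obtain ⟨a1, a2⟩ := h.first_zero hl
  have w1 : w₁ = 0 := by rw [h.hw₁, a1, smul_zero]
  obtain ⟨w2, w3⟩ := eq_zero_of_eq_smul_mulVec hC₂.le hb (u := w₂) (v := w₃)
    (by conv_lhs => rw [h.hw₂, a2, w1]
        simp) (by conv_lhs => rw [h.hw₃, hc]
                  simp)
  obtain ⟨z2, z3⟩ := eq_zero_of_eq_smul_mulVec hC₂.le hb (u := z₂) (v := z₃)
    (by conv_lhs => rw [h.hz₂, a2, hc]
        simp) h.hz₃
  exact ⟨by rw [h.hz₁, a1, z2]; simp, w1, z2, w2, z3, w3⟩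

theorem eq_zero_of_second_ne (hC₁ : ‖C₁‖ = 1) (hb : ‖b 0‖ < 1)
    (h : JetKernel C₁ C₂ b c l z₁ w₁ z₂ w₂ z₃ w₃) (hl : l 1 ≠ 0) (hc : c 0 = 0) :
    z₁ = 0 ∧ w₁ = 0 ∧ z₂ = 0 ∧ w₂ = 0 ∧ z₃ = 0 ∧ w₃ = 0 := by
  obtain ⟨a3, a4⟩ := h.second_zero hl
  have z3 : z₃ = 0 := by rw [h.hz₃, a4, smul_zero]
  obtain ⟨w1, w2⟩ := eq_zero_of_eq_smul_mulVec hC₁.le hb (u := w₁) (v := w₂) h.hw₁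
    (by conv_lhs => rw [h.hw₂, a3, hc]
        simp)
  obtain ⟨z1, z2⟩ := eq_zero_of_eq_smul_mulVec hC₁.le hb (u := z₁) (v := z₂)
    (by conv_lhs => rw [h.hz₁, hc]
        simp) (by conv_lhs => rw [h.hz₂, a3, z3]
                  simp)
  exact ⟨z1, w1, z2, w2, z3, by rw [h.hw₃, a4, w2]; simp⟩

/-- Here `c 1` may couple the two pairs, but below the extremal modulus `1 - ‖b 1‖²` the coupling is
too weak for a nonzero solution. -/
theorem eq_zero_of_second_norm_lt (hC₂ : ‖C₂‖ = 1)
    (h : JetKernel C₁ C₂ b c l z₁ w₁ z₂ w₂ z₃ w₃) (hl : l 0 ≠ 0)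
    (hc : ‖c 1‖ < 1 - ‖b 1‖ ^ 2) :
    z₁ = 0 ∧ w₁ = 0 ∧ z₂ = 0 ∧ w₂ = 0 ∧ z₃ = 0 ∧ w₃ = 0 := by
  obtain ⟨a1, a2⟩ := h.first_zero hl
  have w1 : w₁ = 0 := by rw [h.hw₁, a1, smul_zero]
  obtain ⟨z2, w3⟩ := eq_zero_of_norm_lt_one_sub hC₂.le hc (z := z₂) (w' := z₃) (w := w₃) (z' := w₂)
    (by conv_lhs => rw [h.hz₂, a2]
        simp) h.hz₃ h.hw₃ (by conv_lhs => rw [h.hw₂, a2, w1]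
                              simp)
  exact ⟨by rw [h.hz₁, a1, z2]; simp, w1, z2, by rw [h.hw₂, a2, w1, w3]; simp,
    by rw [h.hz₃, z2]; simp, w3⟩

theorem eq_zero_of_first_norm_lt (hC₁ : ‖C₁‖ = 1)
    (h : JetKernel C₁ C₂ b c l z₁ w₁ z₂ w₂ z₃ w₃) (hl : l 1 ≠ 0)
    (hc : ‖c 0‖ < 1 - ‖b 0‖ ^ 2) :
    z₁ = 0 ∧ w₁ = 0 ∧ z₂ = 0 ∧ w₂ = 0 ∧ z₃ = 0 ∧ w₃ = 0 := by
  obtain ⟨a3, a4⟩ := h.second_zero hl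
  have z3 : z₃ = 0 := by rw [h.hz₃, a4, smul_zero]
  obtain ⟨z1, w2⟩ := eq_zero_of_norm_lt_one_sub hC₁.le hc (z := z₁) (w' := z₂) (w := w₂) (z' := w₁)
    h.hz₁ (by conv_lhs => rw [h.hz₂, a3, z3]
              simp) (by conv_lhs => rw [h.hw₂, a3]
                        simp) h.hw₁
  exact ⟨z1, by rw [h.hw₁, w2]; simp, by rw [h.hz₂, a3, z3, z1]; simp, w2, z3,
    by rw [h.hw₃, a4, w2]; simp⟩

end JetKernel

end JetKernel

/-! ### Jets of size two and the shape of the derivative -/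

section TwoJets

variable {k m n N : ℕ} {C₁ : Matrix (Fin k) (Fin m) ℂ} {C₂ : Matrix (Fin m) (Fin n) ℂ}
  {φ : ∀ N, Tuple 2 N → Tuple 2 N}

/-- The slices of a vector indexed by a product. -/
def slice {ι κ : Type*} (q : ι × κ → ℂ) (a : κ) : ι → ℂ := fun i => q (i, a)

theorem slice_kronecker_mulVec {ι ι' κ κ' : Type*} [Fintype ι] [Fintype κ] (C : Matrix ι' ι ℂ)
    (Y : Matrix κ' κ ℂ) (q : ι × κ → ℂ) (a : κ') :
    slice ((C ⊗ₖ Y) *ᵥ q) a = ∑ c, Y a c • (C *ᵥ slice q c) := by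
  ext i
  simp only [slice, Matrix.mulVec, dotProduct, Fintype.sum_prod_type, Matrix.kroneckerMap_apply,
    Finset.sum_apply, Pi.smul_apply, smul_eq_mul, Finset.mul_sum]
  rw [Finset.sum_comm]
  exact Finset.sum_congr rfl fun _ _ => Finset.sum_congr rfl fun _ _ => by ring

theorem sqNorm_eq_sum_slice {ι κ : Type*} [Fintype ι] [Fintype κ] (q : ι × κ → ℂ) :
    sqNorm q = ∑ a, sqNorm (slice q a) := by
  simp only [sqNorm, Fintype.sum_prod_type, slice]
  exact Finset.sum_comm

theorem sqNorm_kronecker_mulVec_of_diagonal {ι ι' κ κ' : Type*} [Fintype ι] [Fintype κ]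
    [Fintype ι'] [Fintype κ'] [DecidableEq κ] (C : Matrix ι' ι ℂ) {Y : Matrix κ' κ ℂ} {d : κ → ℝ}
    (hY : Yᴴ * Y = Matrix.diagonal fun a => (d a : ℂ)) (q : ι × κ → ℂ) :
    sqNorm ((C ⊗ₖ Y) *ᵥ q) = ∑ a, d a * sqNorm (C *ᵥ slice q a) := by
  have h := sqNorm_mulVec (C ⊗ₖ Y) q
  rw [Matrix.conjTranspose_kronecker, ← Matrix.mul_kronecker_mul, hY] at h
  have h2 : star q ⬝ᵥ ((Cᴴ * C) ⊗ₖ (Matrix.diagonal fun a => (d a : ℂ))) *ᵥ q =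
      ∑ a, (d a : ℂ) * (star (slice q a) ⬝ᵥ ((Cᴴ * C) *ᵥ slice q a)) := by
    have h3 : ∀ r : ι × κ → ℂ, star q ⬝ᵥ r = ∑ a, star (slice q a) ⬝ᵥ slice r a := by
      intro r
      simp only [dotProduct, Fintype.sum_prod_type, slice, Pi.star_apply]
      exact Finset.sum_comm
    rw [h3]
    refine Finset.sum_congr rfl fun a _ => ?_
    rw [slice_kronecker_mulVec, Finset.sum_eq_single a]
    · rw [Matrix.diagonal_apply_eq, dotProduct_smul, smul_eq_mul]
    · intro c _ hc
      rw [Matrix.diagonal_apply_ne _ hc.symm, zero_smul]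
    · simp
  rw [h2] at h
  simp only [← sqNorm_mulVec] at h
  exact_mod_cast h

theorem mem_closedSpec_of_diagonal {Z : Tuple 2 N} {d e : Fin N → ℝ}
    (h₀ : (Z 0)ᴴ * Z 0 = Matrix.diagonal fun a => (d a : ℂ))
    (h₁ : Z 1 * (Z 1)ᴴ = Matrix.diagonal fun a => (e a : ℂ))
    (h : ∀ a v, d a * sqNorm (C₁ *ᵥ v) + e a * sqNorm (C₂ᴴ *ᵥ v) ≤ sqNorm v) :
    Z ∈ closedSpec (blockPair C₁ C₂) N := by
  refine mem_closedSpec_iff.2 fun q => ?_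
  rw [Matrix.conjTranspose_kronecker, sqNorm_kronecker_mulVec_of_diagonal C₁ h₀,
    sqNorm_kronecker_mulVec_of_diagonal C₂ᴴ (by rwa [Matrix.conjTranspose_conjTranspose]),
    sqNorm_eq_sum_slice q, ← Finset.sum_add_distrib]
  exact Finset.sum_le_sum fun a _ => h a _

theorem sqNorm_mulVec_le_self {p q : ℕ} {C : Matrix (Fin p) (Fin q) ℂ} (hC : ‖C‖ = 1)
    (v : Fin q → ℂ) : sqNorm (C *ᵥ v) ≤ sqNorm v := by
  simpa [hC] using sqNorm_mulVec_le C v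

/-- The pair of `2 × 2` matrices with upper right entries `h`. -/
def nilPair (h : Fin 2 → ℂ) : Tuple 2 2 := fun j => !![0, h j; 0, 0]

/-- The pair of upper triangular `2 × 2` matrices with diagonal `b` and upper right entries `h`. -/
def jetPair (b h : Fin 2 → ℂ) : Tuple 2 2 := fun j => !![b j, h j; 0, b j]

theorem nilPair_isSuperdiagonal (h : Fin 2 → ℂ) : IsSuperdiagonal (nilPair h) := by
  intro j a c hac
  fin_cases a <;> fin_cases c <;> simp [nilPair] at hac ⊢

/-- `Z₀ᴴZ₀` and `Z₁Z₁ᴴ` live on different coordinates, so the two coefficients never meet. -/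
theorem nilPair_mem_closedSpec (hC₁ : ‖C₁‖ = 1) (hC₂ : ‖C₂‖ = 1) {h : Fin 2 → ℂ}
    (hh : ∀ j, ‖h j‖ ≤ 1) : nilPair h ∈ closedSpec (blockPair C₁ C₂) 2 := by
  refine mem_closedSpec_of_diagonal (d := ![0, ‖h 0‖ ^ 2]) (e := ![‖h 1‖ ^ 2, 0]) ?_ ?_ ?_
  · ext a c
    fin_cases a <;> fin_cases c <;>
      simp [nilPair, Matrix.mul_apply, Fin.sum_univ_two, Complex.conj_mul']
  · ext a c
    fin_cases a <;> fin_cases c <;>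
      simp [nilPair, Matrix.mul_apply, Fin.sum_univ_two, Complex.mul_conj']
  · intro a v
    have e1 := sqNorm_mulVec_le_self hC₁ v
    have e2 := sqNorm_mulVec_le_self (C₂.l2_opNorm_conjTranspose.trans hC₂) v
    have n1 := sqNorm_nonneg (C₁ *ᵥ v)
    have n2 := sqNorm_nonneg (C₂ᴴ *ᵥ v)
    have s0 : ‖h 0‖ ^ 2 ≤ 1 := pow_le_one₀ (norm_nonneg _) (hh 0)
    have s1 : ‖h 1‖ ^ 2 ≤ 1 := pow_le_one₀ (norm_nonneg _) (hh 1)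
    fin_cases a
    · simp; nlinarith
    · simp; nlinarith

theorem sqNorm_fin_two (v : Fin 2 → ℂ) : sqNorm v = ‖v 0‖ ^ 2 + ‖v 1‖ ^ 2 := by
  simp [sqNorm, Fin.sum_univ_two]

theorem nilPair_notMem_interiorSpec (hC₁ : ‖C₁‖ = 1) (hC₂ : ‖C₂‖ = 1) {h : Fin 2 → ℂ} {j : Fin 2}
    (hj : ‖h j‖ = 1) : nilPair h ∉ interiorSpec (blockPair C₁ C₂) 2 := by
  intro hmem
  have h1 := interiorSpec_subset_freeBidisk hC₁ hC₂ hmem j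
  have h2 := sqNorm_mulVec_le (nilPair h j) ![0, 1]
  rw [sqNorm_fin_two, sqNorm_fin_two] at h2
  simp [nilPair, hj] at h2
  exact h1.not_ge h2

theorem IsBoundaryJet.eq_jetPair {h : Fin 2 → ℂ} {Q : Tuple 2 2}
    (hQ : IsBoundaryJet φ (nilPair h) Q) :
    Q = jetPair (originValue φ) (originDeriv φ *ᵥ h) := by
  ext j a c
  fin_cases a <;> fin_cases c
  · simpa [jetPair] using hQ.diag j 0
  · simpa [jetPair, nilPair, Matrix.mulVec, dotProduct] using hQ.super j 0 1 (by simp)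
  · simpa [jetPair] using hQ.lower j 1 0 (by simp)
  · simpa [jetPair] using hQ.diag j 1

theorem jetPair_mem_closedSpec (hC₁ : ‖C₁‖ = 1) (hC₂ : ‖C₂‖ = 1)
    (hφ : IsFreeAnalytic (blockPair C₁ C₂) (blockPair C₁ C₂) φ) {h : Fin 2 → ℂ}
    (hh : ∀ j, ‖h j‖ ≤ 1) :
    jetPair (originValue φ) (originDeriv φ *ᵥ h) ∈ closedSpec (blockPair C₁ C₂) 2 := by
  have hc := nilPair_mem_closedSpec hC₁ hC₂ hh
  obtain ⟨Q, hQ⟩ := exists_isBoundaryJet hC₁ hC₂ hφ (nilPair_isSuperdiagonal h) hc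
  rw [← hQ.eq_jetPair]
  exact hQ.mem_closedSpec hφ hc

theorem jetPair_notMem_interiorSpec (hC₁ : ‖C₁‖ = 1) (hC₂ : ‖C₂‖ = 1)
    (hφ : IsFreeBianalytic (blockPair C₁ C₂) (blockPair C₁ C₂) φ) {h : Fin 2 → ℂ}
    (hh : ∀ j, ‖h j‖ ≤ 1) {j : Fin 2} (hj : ‖h j‖ = 1) :
    jetPair (originValue φ) (originDeriv φ *ᵥ h) ∉ interiorSpec (blockPair C₁ C₂) 2 := by
  have hc := nilPair_mem_closedSpec hC₁ hC₂ hh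
  obtain ⟨Q, hQ⟩ := exists_isBoundaryJet hC₁ hC₂ hφ.1 (nilPair_isSuperdiagonal h) hc
  rw [← hQ.eq_jetPair]
  exact hQ.notMem_interiorSpec hφ hc (nilPair_notMem_interiorSpec hC₁ hC₂ hj)

theorem slice_ext {ι : Type*} {q r : ι × Fin 2 → ℂ} (h0 : slice q 0 = slice r 0)
    (h1 : slice q 1 = slice r 1) : q = r := by
  ext ⟨i, a⟩
  fin_cases a
  · exact congrFun h0 i
  · exact congrFun h1 i

/-- The kernel equations at a boundary jet in the direction of a coordinate axis. -/
theorem exists_jetKernel (hC₁ : ‖C₁‖ = 1) (hC₂ : ‖C₂‖ = 1)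
    (hφ : IsFreeBianalytic (blockPair C₁ C₂) (blockPair C₁ C₂) φ) {p r : Fin 2} (hpr : p ≠ r) :
    ∃ z₁ w₁ z₂ w₂ z₃ w₃, JetKernel C₁ C₂ (originValue φ) (fun j => originDeriv φ j p)
      (fun j => originDeriv φ j r) z₁ w₁ z₂ w₂ z₃ w₃ ∧
      ¬ (z₁ = 0 ∧ w₁ = 0 ∧ z₂ = 0 ∧ w₂ = 0 ∧ z₃ = 0 ∧ w₃ = 0) := by
  set b := originValue φ
  set K := originDeriv φ
  set E := blockPair C₁ C₂
  have hQ : ∀ c : ℂ, jetPair b (K *ᵥ (Pi.single p 1 + c • Pi.single r 1)) =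
      jetPair b (fun j => K j p) + c • nilPair (fun j => K j r) := by
    intro c
    have hvec : K *ᵥ (Pi.single p 1 + c • Pi.single r 1) =
        (fun j => K j p) + c • fun j => K j r := by
      rw [Matrix.mulVec_add, Matrix.mulVec_smul, Matrix.mulVec_single_one, Matrix.mulVec_single_one]
      rfl
    rw [hvec]
    ext j a d
    fin_cases a <;> fin_cases d <;> simp [jetPair, nilPair]
  have hlin : ∀ c : ℂ, linearPencil E (jetPair b (fun j => K j p) + c • nilPair (fun j => K j r)) =
      linearPencil E (jetPair b fun j => K j p) + c • linearPencil E (nilPair fun j => K j r) := by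
    intro c
    simp only [linearPencil, Pi.add_apply, Pi.smul_apply, Matrix.kronecker_add,
      Matrix.kronecker_smul, Finset.sum_add_distrib, Finset.smul_sum]
  have hnorm : ∀ c : ℂ, ‖c‖ ≤ 1 → ∀ j, ‖(Pi.single p 1 + c • Pi.single r 1 : Fin 2 → ℂ) j‖ ≤ 1 := by
    intro c hc j
    by_cases hj : j = p
    · subst hj
      simp [Pi.single_eq_of_ne hpr]
    · by_cases hj' : j = r
      · subst hj'
        simpa [Pi.single_eq_of_ne hj] using hc
      · simp [Pi.single_eq_of_ne hj, Pi.single_eq_of_ne hj']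
  -- The directions `e_p + c e_r` all stay in the closed polydisk, and the image pencil is affine in
  -- `c`. A null vector at `c = 0` is therefore also killed by the perturbation and its adjoint.
  have hpsd : ∀ c : ℂ, ‖c‖ ≤ 1 → (monicPencil E (jetPair b fun j => K j p) -
      c • linearPencil E (nilPair fun j => K j r) -
      (c • linearPencil E (nilPair fun j => K j r))ᴴ).PosSemidef := by
    intro c hc
    have h1 : (monicPencil E _).PosSemidef := jetPair_mem_closedSpec hC₁ hC₂ hφ.1 (hnorm c hc)
    rw [hQ] at h1
    convert h1 using 1
    rw [monicPencil, monicPencil, hlin, Matrix.conjTranspose_add]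
    abel
  have hQ0 := hQ 0
  rw [zero_smul, zero_smul, add_zero, add_zero] at hQ0
  have hnot : ¬ (monicPencil E (jetPair b fun j => K j p)).PosDef := by
    have := jetPair_notMem_interiorSpec hC₁ hC₂ hφ (h := Pi.single p 1)
      (by simpa using hnorm 0 (by simp)) (j := p) (by simp)
    rwa [hQ0] at this
  have hherm := monicPencil_isHermitian E (jetPair b fun j => K j p)
  obtain ⟨x, hx0, hx⟩ : ∃ x, x ≠ 0 ∧
      star x ⬝ᵥ (monicPencil E (jetPair b fun j => K j p) *ᵥ x) = 0 := by
    by_contra hcon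
    push Not at hcon
    have hp := hpsd 0 (by simp)
    simp only [zero_smul, sub_zero, Matrix.conjTranspose_zero] at hp
    exact hnot (Matrix.PosDef.of_dotProduct_mulVec_pos hherm fun x hx0 =>
      lt_of_le_of_ne (hp.dotProduct_mulVec_nonneg x) (hcon x hx0).symm)
  obtain ⟨k0, k1, k2⟩ := mulVec_eq_zero_of_posSemidef hpsd hx
  have hfix : x = linearPencil E (jetPair b fun j => K j p) *ᵥ x +
      (linearPencil E (jetPair b fun j => K j p))ᴴ *ᵥ x := by
    rw [monicPencil, Matrix.sub_mulVec, Matrix.sub_mulVec, Matrix.one_mulVec, sub_sub,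
      sub_eq_zero] at k0
    exact k0
  have f1 : blk₁ x = (C₁ ⊗ₖ jetPair b (fun j => K j p) 0) *ᵥ blk₂ x := by
    rw [← add_zero ((C₁ ⊗ₖ jetPair b (fun j => K j p) 0) *ᵥ blk₂ x),
      ← blk₁_linearPencil_mulVec C₁ C₂, ← blk₁_linearPencil_conjTranspose_mulVec C₁ C₂ x
        (jetPair b fun j => K j p)]
    exact congrArg blk₁ hfix
  have f2 : blk₂ x = (C₂ ⊗ₖ jetPair b (fun j => K j p) 1) *ᵥ blk₃ x +
      (C₁ ⊗ₖ jetPair b (fun j => K j p) 0)ᴴ *ᵥ blk₁ x := by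
    rw [← blk₂_linearPencil_mulVec C₁ C₂, ← blk₂_linearPencil_conjTranspose_mulVec C₁ C₂]
    exact congrArg blk₂ hfix
  have f3 : blk₃ x = (C₂ ⊗ₖ jetPair b (fun j => K j p) 1)ᴴ *ᵥ blk₂ x := by
    rw [← zero_add ((C₂ ⊗ₖ jetPair b (fun j => K j p) 1)ᴴ *ᵥ blk₂ x),
      ← blk₃_linearPencil_conjTranspose_mulVec C₁ C₂, ← blk₃_linearPencil_mulVec C₁ C₂ x
        (jetPair b fun j => K j p)]
    exact congrArg blk₃ hfix
  have g1 : (C₁ ⊗ₖ nilPair (fun j => K j r) 0) *ᵥ blk₂ x = 0 := by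
    rw [← blk₁_linearPencil_mulVec C₁ C₂, k1]
    rfl
  have g2 : (C₂ ⊗ₖ nilPair (fun j => K j r) 1) *ᵥ blk₃ x = 0 := by
    rw [← blk₂_linearPencil_mulVec C₁ C₂, k1]
    rfl
  have g3 : (C₁ ⊗ₖ nilPair (fun j => K j r) 0)ᴴ *ᵥ blk₁ x = 0 := by
    rw [← blk₂_linearPencil_conjTranspose_mulVec C₁ C₂, k2]
    rfl
  have g4 : (C₂ ⊗ₖ nilPair (fun j => K j r) 1)ᴴ *ᵥ blk₂ x = 0 := by
    rw [← blk₃_linearPencil_conjTranspose_mulVec C₁ C₂, k2]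
    rfl
  rw [Matrix.conjTranspose_kronecker] at f2 f3 g3 g4
  have hz : ∀ {ι : Type} (a : Fin 2), slice (0 : ι × Fin 2 → ℂ) a = 0 := fun a => rfl
  have hadd : ∀ {ι : Type} (q r : ι × Fin 2 → ℂ) (a : Fin 2),
    slice (q + r) a = slice q a + slice r a := fun _ _ _ => rfl
  refine ⟨slice (blk₁ x) 0, slice (blk₁ x) 1, slice (blk₂ x) 0, slice (blk₂ x) 1,
    slice (blk₃ x) 0, slice (blk₃ x) 1, ⟨?_, ?_, ?_, ?_, ?_, ?_, ?_, ?_, ?_, ?_⟩, ?_⟩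
  · have := congrArg (slice · 0) f1
    simpa [slice_kronecker_mulVec, Fin.sum_univ_two, jetPair] using this
  · have := congrArg (slice · 1) f1
    simpa [slice_kronecker_mulVec, Fin.sum_univ_two, jetPair] using this
  · have := congrArg (slice · 0) f2
    simpa [slice_kronecker_mulVec, Fin.sum_univ_two, jetPair, hadd, add_comm] using this
  · have := congrArg (slice · 1) f2
    simpa [slice_kronecker_mulVec, Fin.sum_univ_two, jetPair, hadd, add_comm] using this
  · have := congrArg (slice · 0) f3
    simpa [slice_kronecker_mulVec, Fin.sum_univ_two, jetPair] using this
  · have := congrArg (slice · 1) f3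
    simpa [slice_kronecker_mulVec, Fin.sum_univ_two, jetPair] using this
  · have := congrArg (slice · 0) g1
    simpa [slice_kronecker_mulVec, Fin.sum_univ_two, nilPair, hz] using this
  · have := congrArg (slice · 0) g2
    simpa [slice_kronecker_mulVec, Fin.sum_univ_two, nilPair, hz] using this
  · have := congrArg (slice · 1) g3
    simpa [slice_kronecker_mulVec, Fin.sum_univ_two, nilPair, hz] using this
  · have := congrArg (slice · 1) g4
    simpa [slice_kronecker_mulVec, Fin.sum_univ_two, nilPair, hz] using this
  · rintro ⟨a1, a2, a3, a4, a5, a6⟩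
    exact hx0 (eq_zero_of_blk (slice_ext a1 a2) (slice_ext a3 a4) (slice_ext a5 a6))

theorem norm_le_one_sub_of_forall {b c : ℂ}
    (h : ∀ s : ℂ, ‖b * s + c‖ ^ 2 + ‖b‖ ^ 2 ≤ ‖s‖ ^ 2 + 1) : ‖c‖ ≤ 1 - ‖b‖ ^ 2 := by
  rcases eq_or_ne c 0 with rfl | hc
  · have := h 0
    simp at this ⊢
    exact this
  · have hc0 : (‖c‖ : ℂ) ≠ 0 := by simpa using hc
    have e : b * (star b * c / ‖c‖) + c = ((‖b‖ ^ 2 + ‖c‖ : ℝ) : ℂ) * (c / ‖c‖) := by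
      have hb : b * star b = (‖b‖ : ℂ) ^ 2 := Complex.mul_conj' b
      push_cast
      field_simp
      rw [hb]
    -- This `s` aligns `b * s` with `c` and has modulus `‖b‖`, leaving `(‖b‖² + ‖c‖)² ≤ 1`.
    have h1 := h (star b * c / ‖c‖)
    have hu : ‖c / (‖c‖ : ℂ)‖ = 1 := by
      rw [norm_div, Complex.norm_real, norm_norm, div_self (by simpa using hc)]
    rw [e, norm_mul, hu, mul_div_assoc, norm_mul, hu, norm_star, Complex.norm_real,
      Real.norm_eq_abs, mul_one, mul_one, sq_abs] at h1
    nlinarith [norm_nonneg c, sq_nonneg ‖b‖]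

theorem norm_le_of_jetPair_mem_closedSpec (hC₁ : ‖C₁‖ = 1) (hC₂ : ‖C₂‖ = 1) {b h : Fin 2 → ℂ}
    (hQ : jetPair b h ∈ closedSpec (blockPair C₁ C₂) 2) (j : Fin 2) :
    ‖h j‖ ≤ 1 - ‖b j‖ ^ 2 := by
  fin_cases j
  · refine norm_le_one_sub_of_forall fun s => ?_
    have := sqNorm_mulVec_zero_le hC₁ hQ ![s, 1]
    simpa [sqNorm_fin_two, jetPair, mul_comm] using this
  · have : ‖star (h 1)‖ ≤ 1 - ‖star (b 1)‖ ^ 2 := by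
      refine norm_le_one_sub_of_forall fun s => ?_
      have := sqNorm_conjTranspose_mulVec_one_le hC₂ hQ ![1, s]
      simp [sqNorm_fin_two, jetPair] at this
      rw [norm_star, add_comm (star (b 1) * s)]
      simp only [Complex.star_def]
      linarith
    simpa using this

theorem norm_originDeriv_le (hC₁ : ‖C₁‖ = 1) (hC₂ : ‖C₂‖ = 1)
    (hφ : IsFreeAnalytic (blockPair C₁ C₂) (blockPair C₁ C₂) φ) (j p : Fin 2) :
    ‖originDeriv φ j p‖ ≤ 1 - ‖originValue φ j‖ ^ 2 := by
  have := norm_le_of_jetPair_mem_closedSpec hC₁ hC₂ (jetPair_mem_closedSpec hC₁ hC₂ hφ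
    (h := Pi.single p 1) fun i => by
      by_cases hi : i = p
      · subst hi; simp
      · simp [Pi.single_eq_of_ne hi]) j
  simpa [Matrix.mulVec_single_one] using this

theorem norm_originValue_lt_one (hC₁ : ‖C₁‖ = 1) (hC₂ : ‖C₂‖ = 1)
    (hφ : IsFreeAnalytic (blockPair C₁ C₂) (blockPair C₁ C₂) φ) (j : Fin 2) :
    ‖originValue φ j‖ < 1 := by
  have h1 := interiorSpec_subset_freeBidisk hC₁ hC₂
    (hφ.mapsTo 1 (zero_mem_interiorSpec hC₁ hC₂)) j
  have h2 := sqNorm_mulVec_le (φ 1 0 j) ![1]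
  simp [sqNorm, Matrix.mulVec, dotProduct] at h2
  exact ((pow_le_pow_iff_left₀ (norm_nonneg _) (norm_nonneg _) two_ne_zero).1 h2).trans_lt h1

/-- The derivative at the origin is diagonal or antidiagonal, with entries of maximal modulus. -/
theorem originDeriv_dichotomy (hC₁ : ‖C₁‖ = 1) (hC₂ : ‖C₂‖ = 1)
    (hφ : IsFreeBianalytic (blockPair C₁ C₂) (blockPair C₁ C₂) φ) :
    (originDeriv φ 0 1 = 0 ∧ originDeriv φ 1 0 = 0 ∧
      ‖originDeriv φ 0 0‖ = 1 - ‖originValue φ 0‖ ^ 2 ∧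
      ‖originDeriv φ 1 1‖ = 1 - ‖originValue φ 1‖ ^ 2) ∨
    (originDeriv φ 0 0 = 0 ∧ originDeriv φ 1 1 = 0 ∧
      ‖originDeriv φ 0 1‖ = 1 - ‖originValue φ 0‖ ^ 2 ∧
      ‖originDeriv φ 1 0‖ = 1 - ‖originValue φ 1‖ ^ 2) := by
  have hb := norm_originValue_lt_one hC₁ hC₂ hφ.1
  have hle := norm_originDeriv_le hC₁ hC₂ hφ.1
  obtain ⟨z₁, w₁, z₂, w₂, z₃, w₃, J, hne⟩ := exists_jetKernel hC₁ hC₂ hφ (p := 0) (r := 1)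
    (by decide)
  obtain ⟨z₁', w₁', z₂', w₂', z₃', w₃', J', hne'⟩ := exists_jetKernel hC₁ hC₂ hφ (p := 1) (r := 0)
    (by decide)
  -- Each implication excludes a zero pattern under which the kernel equations would have only the
  -- trivial solution.
  have a1 : originDeriv φ 0 1 ≠ 0 → originDeriv φ 1 1 = 0 := fun h => by
    by_contra h'; exact hne (J.eq_zero_of_ne_of_ne h h')
  have a2 : originDeriv φ 0 0 ≠ 0 → originDeriv φ 1 0 = 0 := fun h => by
    by_contra h'; exact hne' (J'.eq_zero_of_ne_of_ne h h')
  have a3 : originDeriv φ 0 1 ≠ 0 → originDeriv φ 1 0 ≠ 0 := fun h h' =>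
    hne (J.eq_zero_of_first_ne hC₂ (hb 1) h h')
  have a4 : originDeriv φ 0 0 ≠ 0 → originDeriv φ 1 1 ≠ 0 := fun h h' =>
    hne' (J'.eq_zero_of_first_ne hC₂ (hb 1) h h')
  have a5 : originDeriv φ 1 1 ≠ 0 → originDeriv φ 0 0 ≠ 0 := fun h h' =>
    hne (J.eq_zero_of_second_ne hC₁ (hb 0) h h')
  have a6 : originDeriv φ 1 0 ≠ 0 → originDeriv φ 0 1 ≠ 0 := fun h h' =>
    hne' (J'.eq_zero_of_second_ne hC₁ (hb 0) h h')
  by_cases h00 : originDeriv φ 0 0 = 0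
  · have h11 : originDeriv φ 1 1 = 0 := by
      by_contra h; exact a5 h h00
    have h01 : originDeriv φ 0 1 ≠ 0 := by
      intro h01
      have h10 : originDeriv φ 1 0 = 0 := by
        by_contra h; exact a6 h h01
      -- With a vanishing first column, this boundary jet would map to `φ(0)`, an interior point.
      refine jetPair_notMem_interiorSpec hC₁ hC₂ hφ (h := Pi.single 0 1) (j := 0) (fun i => by
        fin_cases i <;> simp) (by simp) ?_
      have hv : originDeriv φ *ᵥ Pi.single 0 1 = 0 := by
        rw [Matrix.mulVec_single_one]
        ext j
        fin_cases j
        · exact h00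
        · exact h10
      have : jetPair (originValue φ) 0 = φ 2 0 := by
        rw [map_zero_eq hC₁ hC₂ hφ.1]
        ext j a c
        fin_cases a <;> fin_cases c <;> simp [jetPair]
      rw [hv, this]
      exact hφ.1.mapsTo 2 (zero_mem_interiorSpec hC₁ hC₂)
    have h10 := a3 h01
    refine Or.inr ⟨h00, h11, le_antisymm (hle 0 1) ?_, le_antisymm (hle 1 0) ?_⟩
    · by_contra h
      exact hne' (J'.eq_zero_of_first_norm_lt hC₁ h10 (not_le.1 h))
    · by_contra h
      exact hne (J.eq_zero_of_second_norm_lt hC₂ h01 (not_le.1 h))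
  · have h11 := a4 h00
    have h10 := a2 h00
    have h01 : originDeriv φ 0 1 = 0 := by
      by_contra h; exact h11 (a1 h)
    refine Or.inl ⟨h01, h10, le_antisymm (hle 0 0) ?_, le_antisymm (hle 1 1) ?_⟩
    · by_contra h
      exact hne (J.eq_zero_of_first_norm_lt hC₁ h11 (not_le.1 h))
    · by_contra h
      exact hne' (J'.eq_zero_of_second_norm_lt hC₂ h00 (not_le.1 h))

end TwoJets

/-! ### Jets of size three and rigidity -/

section ThreeJets

variable {k m n N : ℕ} {C₁ : Matrix (Fin k) (Fin m) ℂ} {C₂ : Matrix (Fin m) (Fin n) ℂ}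
  {φ : ∀ N, Tuple 2 N → Tuple 2 N}

/-- If `C₁ᴴ * C₁ + C₂ * C₂ᴴ` is not a contraction, its norm is `s⁻²` with `s < 1`, and the norm is
attained. -/
theorem exists_extremal_vector (hC₁ : ‖C₁‖ = 1)
    (hC : ¬ (1 - (C₁ᴴ * C₁ + C₂ * C₂ᴴ)).PosSemidef) :
    ∃ s : ℝ, 0 < s ∧ s < 1 ∧
      (∀ w, s ^ 2 * (sqNorm (C₁ *ᵥ w) + sqNorm (C₂ᴴ *ᵥ w)) ≤ sqNorm w) ∧
      ∃ v, sqNorm v = 1 ∧ s ^ 2 * (sqNorm (C₁ *ᵥ v) + sqNorm (C₂ᴴ *ᵥ v)) = 1 := by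
  have := nonempty_of_norm_eq_one hC₁
  -- Stacking gives `KᴴK = C₁ᴴC₁ + C₂C₂ᴴ`, so `s = ‖K‖⁻¹` works and `v` norms `K`.
  set K := Matrix.fromRows C₁ C₂ᴴ with hK
  have hsq : ∀ w, sqNorm (K *ᵥ w) = sqNorm (C₁ *ᵥ w) + sqNorm (C₂ᴴ *ᵥ w) := by
    intro w
    rw [hK, Matrix.fromRows_mulVec]
    simp [sqNorm]
  have hKK : Kᴴ * K = C₁ᴴ * C₁ + C₂ * C₂ᴴ := by
    rw [hK, Matrix.conjTranspose_fromRows_eq_fromCols_conjTranspose, Matrix.fromCols_mul_fromRows,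
      Matrix.conjTranspose_conjTranspose]
  have hgt : 1 < ‖K‖ := by
    by_contra h
    refine hC ?_
    rw [← hKK]
    exact posSemidef_one_sub_conjTranspose_mul_self (not_lt.1 h)
  have hpos : 0 < ‖K‖ := one_pos.trans hgt
  obtain ⟨v, hv, hv'⟩ := exists_sqNorm_mulVec_eq K
  refine ⟨‖K‖⁻¹, inv_pos.2 hpos, inv_lt_one_of_one_lt₀ hgt, fun w => ?_, v, hv, ?_⟩
  · rw [← hsq, inv_pow, inv_mul_le_iff₀ (by positivity)]
    exact sqNorm_mulVec_le K w
  · rw [← hsq, hv', inv_pow, inv_mul_cancel₀ (by positivity)]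

/-- Upper triangular `3 × 3` matrices with constant diagonal. -/
def triangular (b x q y : ℂ) : Matrix (Fin 3) (Fin 3) ℂ := !![b, x, q; 0, b, y; 0, 0, b]

theorem sqNorm_ofReal_three (x y z : ℝ) :
    sqNorm ![(x : ℂ), (y : ℂ), (z : ℂ)] = x ^ 2 + y ^ 2 + z ^ 2 := by
  simp [sqNorm, Fin.sum_univ_three]

theorem sqNorm_conjTranspose_mulVec_le {ι : Type*} [Fintype ι] {K : Matrix ι ι ℂ}
    (h : ∀ w, sqNorm (K *ᵥ w) ≤ sqNorm w) (w : ι → ℂ) : sqNorm (Kᴴ *ᵥ w) ≤ sqNorm w := by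
  have h1 := norm_star_dotProduct_sq_le w (K *ᵥ (Kᴴ *ᵥ w))
  rw [star_dotProduct_mulVec, star_dotProduct_self, Complex.norm_real, Real.norm_eq_abs,
    sq_abs] at h1
  have h2 := h (Kᴴ *ᵥ w)
  rcases (sqNorm_nonneg (Kᴴ *ᵥ w)).eq_or_lt with h0 | h0
  · rw [← h0]; exact sqNorm_nonneg w
  · nlinarith [mul_le_mul_of_nonneg_left h2 (sqNorm_nonneg w)]

/-- On `(0, b, 1)` the last two entries of the image already exhaust the norm, so the first must
vanish. The matrix is thus the Möbius transform `(b + W)(1 + bW)⁻¹` of the shift `W` with weights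
`s, 1`. -/
theorem corner_eq_of_contraction {b s : ℝ} {q : ℂ}
    (h : ∀ w, sqNorm (triangular b ((1 - b ^ 2) * s : ℝ) q (1 - b ^ 2 : ℝ) *ᵥ w) ≤ sqNorm w) :
    q = (-((1 - b ^ 2) * s * b) : ℝ) := by
  have h1 := h ![(0 : ℝ), (b : ℝ), (1 : ℝ)]
  rw [sqNorm_ofReal_three] at h1
  have e : triangular b ((1 - b ^ 2) * s : ℝ) q (1 - b ^ 2 : ℝ) *ᵥ
      ![((0 : ℝ) : ℂ), (b : ℂ), ((1 : ℝ) : ℂ)] =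
      ![((1 - b ^ 2) * s * b : ℝ) + q, ((1 : ℝ) : ℂ), (b : ℂ)] := by
    ext i
    fin_cases i <;> simp [triangular, Matrix.mulVec, dotProduct, Fin.sum_univ_three]
    ring
  rw [e] at h1
  simp only [sqNorm, Fin.sum_univ_three, Matrix.cons_val_zero, Matrix.cons_val_one,
    Matrix.cons_val, Complex.norm_real, Real.norm_eq_abs, sq_abs] at h1
  have h2 : ‖((1 - b ^ 2) * s * b : ℝ) + q‖ ^ 2 ≤ 0 := by linarith
  have h3 : ((1 - b ^ 2) * s * b : ℝ) + q = 0 := by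
    rw [← norm_eq_zero]
    exact pow_eq_zero_iff two_ne_zero |>.1 (le_antisymm h2 (sq_nonneg _))
  rw [Complex.ofReal_neg]
  exact (neg_eq_of_add_eq_zero_right h3).symm

theorem corner_eq_of_conjTranspose_contraction {b s : ℝ} {q : ℂ}
    (h : ∀ w, sqNorm ((triangular b (1 - b ^ 2 : ℝ) q ((1 - b ^ 2) * s : ℝ))ᴴ *ᵥ w) ≤ sqNorm w) :
    q = (-((1 - b ^ 2) * s * b) : ℝ) := by
  have h1 := h ![(1 : ℝ), (b : ℝ), (0 : ℝ)]
  rw [sqNorm_ofReal_three] at h1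
  have e : (triangular b (1 - b ^ 2 : ℝ) q ((1 - b ^ 2) * s : ℝ))ᴴ *ᵥ
      ![((1 : ℝ) : ℂ), (b : ℂ), ((0 : ℝ) : ℂ)] =
      ![(b : ℂ), ((1 : ℝ) : ℂ), ((1 - b ^ 2) * s * b : ℝ) + star q] := by
    ext i
    fin_cases i <;> simp [triangular, Matrix.mulVec, dotProduct, Fin.sum_univ_three]
    · ring
    · ring
  rw [e] at h1
  simp only [sqNorm, Fin.sum_univ_three, Matrix.cons_val_zero, Matrix.cons_val_one,
    Matrix.cons_val, Complex.norm_real, Real.norm_eq_abs, sq_abs] at h1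
  have h2 : ‖((1 - b ^ 2) * s * b : ℝ) + star q‖ ^ 2 ≤ 0 := by linarith
  have h3 : ((1 - b ^ 2) * s * b : ℝ) + star q = 0 := by
    rw [← norm_eq_zero]
    exact pow_eq_zero_iff two_ne_zero |>.1 (le_antisymm h2 (sq_nonneg _))
  have h4 := congrArg star (neg_eq_of_add_eq_zero_right h3)
  rw [star_star] at h4
  rw [← h4, Complex.star_def, map_neg, Complex.conj_ofReal, Complex.ofReal_neg]

/-- Once the corners are known, `T_j = (b_j + W_j)(1 + b_j W_j)⁻¹` with `W₀`, `W₁` the shifts of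
weights `s, 1` and `1, s`. The extremal `v` turns the membership inequality into `S ≤ 1`, where `S`
is the squared norm of a test vector with `S ≥ 1 + (b₀s)² + (b₁s)²`. -/
theorem eq_zero_of_diagonal_jet (hC₁ : ‖C₁‖ = 1) (hC₂ : ‖C₂‖ = 1) {s : ℝ} (hs : 0 < s)
    (hs1 : s < 1) {v : Fin m → ℂ} (hv : sqNorm v = 1)
    (hv' : s ^ 2 * (sqNorm (C₁ *ᵥ v) + sqNorm (C₂ᴴ *ᵥ v)) = 1)
    {b₀ b₁ : ℝ} (hb₀ : 0 ≤ b₀) (hb₁ : 0 ≤ b₁) {q₀ q₁ : ℂ} {T : Tuple 2 3}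
    (hT₀ : T 0 = triangular b₀ ((1 - b₀ ^ 2) * s : ℝ) q₀ (1 - b₀ ^ 2 : ℝ))
    (hT₁ : T 1 = triangular b₁ (1 - b₁ ^ 2 : ℝ) q₁ ((1 - b₁ ^ 2) * s : ℝ))
    (hT : T ∈ closedSpec (blockPair C₁ C₂) 3) : b₀ = 0 ∧ b₁ = 0 := by
  have hq₀ := corner_eq_of_contraction (fun w => hT₀ ▸ sqNorm_mulVec_zero_le hC₁ hT w)
  have hq₁ := corner_eq_of_conjTranspose_contraction
    (fun w => hT₁ ▸ sqNorm_conjTranspose_mulVec_one_le hC₂ hT w)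
  -- The test vector is `(1 + b₀W₀)(1 + b₁W₁ᴴ)e₂`, `e₂` the middle basis vector; these factors
  -- commute on `e₂`, so it cancels the denominators of both `T₀` and `T₁ᴴ`.
  have h := sqNorm_product_le hT v
    ![((b₀ * s : ℝ) : ℂ), ((1 + b₀ * b₁ * s : ℝ) : ℂ), ((b₁ * s : ℝ) : ℂ)]
  have e₀ : T 0 *ᵥ ![((b₀ * s : ℝ) : ℂ), ((1 + b₀ * b₁ * s : ℝ) : ℂ), ((b₁ * s : ℝ) : ℂ)] =
      ![(s : ℂ), ((b₀ + b₁ * s : ℝ) : ℂ), ((b₀ * b₁ * s : ℝ) : ℂ)] := by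
    rw [hT₀, hq₀]
    ext i
    fin_cases i <;> simp [triangular, Matrix.mulVec, dotProduct, Fin.sum_univ_three] <;> ring
  have e₁ : (T 1)ᴴ *ᵥ ![((b₀ * s : ℝ) : ℂ), ((1 + b₀ * b₁ * s : ℝ) : ℂ), ((b₁ * s : ℝ) : ℂ)] =
      ![((b₀ * b₁ * s : ℝ) : ℂ), ((b₁ + b₀ * s : ℝ) : ℂ), (s : ℂ)] := by
    rw [hT₁, hq₁]
    ext i
    fin_cases i <;> simp [triangular, Matrix.mulVec, dotProduct, Fin.sum_univ_three] <;> ring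
  rw [e₀, e₁, sqNorm_ofReal_three, sqNorm_ofReal_three, sqNorm_ofReal_three, hv, one_mul] at h
  have na := sqNorm_nonneg (C₁ *ᵥ v)
  have nb := sqNorm_nonneg (C₂ᴴ *ᵥ v)
  set a := sqNorm (C₁ *ᵥ v)
  set d := sqNorm (C₂ᴴ *ᵥ v)
  set S := (b₀ * s) ^ 2 + (1 + b₀ * b₁ * s) ^ 2 + (b₁ * s) ^ 2 with hS
  have i₀ : s ^ 2 + (b₀ + b₁ * s) ^ 2 + (b₀ * b₁ * s) ^ 2 = S - (1 - s ^ 2) * (1 - b₀ ^ 2) := by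
    rw [hS]; ring
  have i₁ : (b₀ * b₁ * s) ^ 2 + (b₁ + b₀ * s) ^ 2 + s ^ 2 = S - (1 - s ^ 2) * (1 - b₁ ^ 2) := by
    rw [hS]; ring
  rw [i₀, i₁] at h
  have hs2 : 0 < 1 - s ^ 2 := by nlinarith
  have h2 := mul_le_mul_of_nonneg_left h (sq_nonneg s)
  have h3 : s ^ 2 * (a * (S - (1 - s ^ 2) * (1 - b₀ ^ 2)) + d * (S - (1 - s ^ 2) * (1 - b₁ ^ 2))) =
      (s ^ 2 * (a + d)) * (S - (1 - s ^ 2)) +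
        s ^ 2 * (1 - s ^ 2) * (a * b₀ ^ 2 + d * b₁ ^ 2) := by ring
  rw [h3, hv', one_mul] at h2
  have h4 : 0 ≤ s ^ 2 * (1 - s ^ 2) * (a * b₀ ^ 2 + d * b₁ ^ 2) := by positivity
  have h5 : (1 - s ^ 2) * (S - 1) ≤ 0 := by linarith
  have h6 : S ≤ 1 := by
    by_contra hcon
    push Not at hcon
    nlinarith
  have h7 : 0 ≤ b₀ * b₁ * s := by positivity
  have h8 : (b₀ * s) ^ 2 + (b₁ * s) ^ 2 ≤ 0 := by nlinarith
  have h9 : (b₀ * s) ^ 2 = 0 := by nlinarith [sq_nonneg (b₀ * s), sq_nonneg (b₁ * s)]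
  have h10 : (b₁ * s) ^ 2 = 0 := by nlinarith [sq_nonneg (b₀ * s), sq_nonneg (b₁ * s)]
  simp only [ne_eq, OfNat.ofNat_ne_zero, not_false_eq_true, pow_eq_zero_iff, mul_eq_zero,
    hs.ne', or_false] at h9 h10
  exact ⟨h9, h10⟩

/-- The shifts now have interchanged weights. The analogous test vector has squared norm `S ≥ 1`,
whereas membership bounds `S` by `max(b₀, b₁)² < 1`. -/
theorem false_of_antidiagonal_jet (hC₁ : ‖C₁‖ = 1) (hC₂ : ‖C₂‖ = 1) {s : ℝ} (hs : 0 < s)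
    (hs1 : s < 1) {v : Fin m → ℂ} (hv : sqNorm v = 1)
    (hv' : s ^ 2 * (sqNorm (C₁ *ᵥ v) + sqNorm (C₂ᴴ *ᵥ v)) = 1)
    {b₀ b₁ : ℝ} (hb₀ : 0 ≤ b₀) (hb₁ : 0 ≤ b₁) (hb₀' : b₀ < 1) (hb₁' : b₁ < 1) {q₀ q₁ : ℂ}
    {T : Tuple 2 3}
    (hT₀ : T 0 = triangular b₀ (1 - b₀ ^ 2 : ℝ) q₀ ((1 - b₀ ^ 2) * s : ℝ))
    (hT₁ : T 1 = triangular b₁ ((1 - b₁ ^ 2) * s : ℝ) q₁ (1 - b₁ ^ 2 : ℝ))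
    (hT : T ∈ closedSpec (blockPair C₁ C₂) 3) : False := by
  have hq₀ := corner_eq_of_conjTranspose_contraction
    (fun w => hT₀ ▸ sqNorm_conjTranspose_mulVec_le (sqNorm_mulVec_zero_le hC₁ hT) w)
  have hq₁ := corner_eq_of_contraction (b := b₁) (s := s) (q := q₁) (fun w => by
    have := sqNorm_conjTranspose_mulVec_le (sqNorm_conjTranspose_mulVec_one_le hC₂ hT) w
    rwa [Matrix.conjTranspose_conjTranspose, hT₁] at this)
  have h := sqNorm_product_le hT v ![(b₀ : ℂ), ((1 + b₀ * b₁ * s : ℝ) : ℂ), (b₁ : ℂ)]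
  have e₀ : T 0 *ᵥ ![(b₀ : ℂ), ((1 + b₀ * b₁ * s : ℝ) : ℂ), (b₁ : ℂ)] =
      ![((1 : ℝ) : ℂ), ((b₀ + b₁ * s : ℝ) : ℂ), ((b₀ * b₁ : ℝ) : ℂ)] := by
    rw [hT₀, hq₀]
    ext i
    fin_cases i <;> simp [triangular, Matrix.mulVec, dotProduct, Fin.sum_univ_three] <;> ring
  have e₁ : (T 1)ᴴ *ᵥ ![(b₀ : ℂ), ((1 + b₀ * b₁ * s : ℝ) : ℂ), (b₁ : ℂ)] =
      ![((b₀ * b₁ : ℝ) : ℂ), ((b₁ + b₀ * s : ℝ) : ℂ), ((1 : ℝ) : ℂ)] := by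
    rw [hT₁, hq₁]
    ext i
    fin_cases i <;> simp [triangular, Matrix.mulVec, dotProduct, Fin.sum_univ_three] <;> ring
  rw [e₀, e₁, sqNorm_ofReal_three, sqNorm_ofReal_three, sqNorm_ofReal_three, hv, one_mul] at h
  have na := sqNorm_nonneg (C₁ *ᵥ v)
  have nb := sqNorm_nonneg (C₂ᴴ *ᵥ v)
  set a := sqNorm (C₁ *ᵥ v)
  set d := sqNorm (C₂ᴴ *ᵥ v)
  set S := b₀ ^ 2 + (1 + b₀ * b₁ * s) ^ 2 + b₁ ^ 2 with hS
  have i₀ : 1 ^ 2 + (b₀ + b₁ * s) ^ 2 + (b₀ * b₁) ^ 2 =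
      S - (1 - s ^ 2) * (b₁ ^ 2 * (1 - b₀ ^ 2)) := by
    rw [hS]; ring
  have i₁ : (b₀ * b₁) ^ 2 + (b₁ + b₀ * s) ^ 2 + 1 ^ 2 =
      S - (1 - s ^ 2) * (b₀ ^ 2 * (1 - b₁ ^ 2)) := by
    rw [hS]; ring
  rw [i₀, i₁] at h
  have hs2 : 0 < 1 - s ^ 2 := by nlinarith
  have h2 := mul_le_mul_of_nonneg_left h (sq_nonneg s)
  have h3 : s ^ 2 * (a * (S - (1 - s ^ 2) * (b₁ ^ 2 * (1 - b₀ ^ 2))) +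
      d * (S - (1 - s ^ 2) * (b₀ ^ 2 * (1 - b₁ ^ 2)))) = (s ^ 2 * (a + d)) * S -
        (1 - s ^ 2) * (s ^ 2 * (a * (b₁ ^ 2 * (1 - b₀ ^ 2)) + d * (b₀ ^ 2 * (1 - b₁ ^ 2)))) := by
    ring
  rw [h3, hv', one_mul] at h2
  have h4 : S ≤ s ^ 2 * (a * (b₁ ^ 2 * (1 - b₀ ^ 2)) + d * (b₀ ^ 2 * (1 - b₁ ^ 2))) := by
    by_contra hcon
    push Not at hcon
    nlinarith
  set c := max b₀ b₁ with hc
  have hc1 : c ^ 2 < 1 := by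
    have : c < 1 := max_lt hb₀' hb₁'
    have : 0 ≤ c := hb₀.trans (le_max_left _ _)
    nlinarith
  have l₀ : b₁ ^ 2 * (1 - b₀ ^ 2) ≤ c ^ 2 := by
    have : b₁ ^ 2 ≤ c ^ 2 := pow_le_pow_left₀ hb₁ (le_max_right _ _) 2
    nlinarith [sq_nonneg (b₀ * b₁)]
  have l₁ : b₀ ^ 2 * (1 - b₁ ^ 2) ≤ c ^ 2 := by
    have : b₀ ^ 2 ≤ c ^ 2 := pow_le_pow_left₀ hb₀ (le_max_left _ _) 2
    nlinarith [sq_nonneg (b₀ * b₁)]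
  have h5 : a * (b₁ ^ 2 * (1 - b₀ ^ 2)) + d * (b₀ ^ 2 * (1 - b₁ ^ 2)) ≤ (a + d) * c ^ 2 := by
    rw [add_mul]
    exact add_le_add (mul_le_mul_of_nonneg_left l₀ na) (mul_le_mul_of_nonneg_left l₁ nb)
  have h6 := mul_le_mul_of_nonneg_left h5 (sq_nonneg s)
  rw [← mul_assoc (s ^ 2) (a + d), hv', one_mul] at h6
  have h7 : 0 ≤ b₀ * b₁ * s := by positivity
  nlinarith [sq_nonneg b₀, sq_nonneg b₁]

/-- The pair of superdiagonal `3 × 3` matrices with superdiagonal entries `x` and `y`. -/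
def nilTriple (x y : Fin 2 → ℂ) : Tuple 2 3 := fun j => !![0, x j, 0; 0, 0, y j; 0, 0, 0]

theorem nilTriple_isSuperdiagonal (x y : Fin 2 → ℂ) : IsSuperdiagonal (nilTriple x y) := by
  intro j a c hac
  fin_cases a <;> fin_cases c <;> simp [nilTriple] at hac ⊢

/-- The weights place `C₁` and `C₂` together only on the middle coordinate, where the factor `s²`
compensates; the outer coordinates involve a single contraction. -/
theorem nilTriple_mem_closedSpec (hC₁ : ‖C₁‖ = 1) (hC₂ : ‖C₂‖ = 1) {s : ℝ}
    (hs : ∀ w, s ^ 2 * (sqNorm (C₁ *ᵥ w) + sqNorm (C₂ᴴ *ᵥ w)) ≤ sqNorm w) {x y : Fin 2 → ℂ}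
    (hx₀ : ‖x 0‖ = s) (hx₁ : ‖x 1‖ = 1) (hy₀ : ‖y 0‖ = 1) (hy₁ : ‖y 1‖ = s) :
    nilTriple x y ∈ closedSpec (blockPair C₁ C₂) 3 := by
  refine mem_closedSpec_of_diagonal (d := ![0, s ^ 2, 1]) (e := ![1, s ^ 2, 0]) ?_ ?_ ?_
  · ext a c
    fin_cases a <;> fin_cases c <;>
      simp [nilTriple, Matrix.mul_apply, Fin.sum_univ_three, Complex.conj_mul', hx₀, hy₀]
  · ext a c
    fin_cases a <;> fin_cases c <;>
      simp [nilTriple, Matrix.mul_apply, Fin.sum_univ_three, Complex.mul_conj', hx₁, hy₁]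
  · intro a v
    fin_cases a
    · simpa using sqNorm_mulVec_le_self (C₂.l2_opNorm_conjTranspose.trans hC₂) v
    · simpa [mul_add] using hs v
    · simpa using sqNorm_mulVec_le_self hC₁ v

theorem exists_norm_one_mul_eq (a : ℂ) : ∃ e : ℂ, ‖e‖ = 1 ∧ a * e = (‖a‖ : ℂ) := by
  rcases eq_or_ne a 0 with rfl | ha
  · exact ⟨1, by simp, by simp⟩
  · have h : ‖a‖ ≠ 0 := by simpa using ha
    have h' : (‖a‖ : ℂ) ≠ 0 := by exact_mod_cast h
    refine ⟨star a / ‖a‖, by simp [h], ?_⟩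
    rw [← mul_div_assoc, Complex.star_def, Complex.mul_conj', sq, mul_div_assoc, div_self h',
      mul_one]

theorem exists_rotated_jet (hC₁ : ‖C₁‖ = 1) (hC₂ : ‖C₂‖ = 1)
    (hφ : IsFreeAnalytic (blockPair C₁ C₂) (blockPair C₁ C₂) φ) {x y γ : Fin 2 → ℂ}
    (hγ : ∀ j, ‖γ j‖ = 1) (hxy : nilTriple x y ∈ closedSpec (blockPair C₁ C₂) 3) :
    ∃ q : Fin 2 → ℂ, (fun j => triangular (γ j * originValue φ j)
      (γ j * ∑ l, originDeriv φ j l * x l) (q j) (γ j * ∑ l, originDeriv φ j l * y l)) ∈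
      closedSpec (blockPair C₁ C₂) 3 := by
  obtain ⟨Q, hQ⟩ := exists_isBoundaryJet hC₁ hC₂ hφ (nilTriple_isSuperdiagonal x y) hxy
  refine ⟨fun j => γ j * Q j 0 2, ?_⟩
  convert circle_smul_mem_closedSpec (hQ.mem_closedSpec hφ hxy) γ hγ using 1
  ext j a c
  have d0 := hQ.diag j 0
  have d1 := hQ.diag j 1
  have d2 := hQ.diag j 2
  have s01 := hQ.super j 0 1 (by simp)
  have s12 := hQ.super j 1 2 (by simp)
  have l10 := hQ.lower j 1 0 (by decide)
  have l20 := hQ.lower j 2 0 (by decide)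
  have l21 := hQ.lower j 2 1 (by decide)
  fin_cases a <;> fin_cases c <;>
    simp [triangular, d0, d1, d2, s01, s12, l10, l20, l21, nilTriple]

/-- If `C₁ᴴ * C₁ + C₂ * C₂ᴴ` is not a contraction, free automorphisms fix the origin and have there
a diagonal unitary derivative. -/
theorem origin_data (hC₁ : ‖C₁‖ = 1) (hC₂ : ‖C₂‖ = 1)
    (hC : ¬ (1 - (C₁ᴴ * C₁ + C₂ * C₂ᴴ)).PosSemidef)
    (hφ : IsFreeBianalytic (blockPair C₁ C₂) (blockPair C₁ C₂) φ) :
    originValue φ = 0 ∧ ∃ γ : Fin 2 → ℂ, (∀ j, ‖γ j‖ = 1) ∧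
      originDeriv φ = Matrix.diagonal γ := by
  obtain ⟨s, hs, hs1, hsle, v, hv, hv'⟩ := exists_extremal_vector hC₁ hC
  choose γ hγ hγb using fun j => exists_norm_one_mul_eq (originValue φ j)
  have hγb' : ∀ j, γ j * originValue φ j = ((‖originValue φ j‖ : ℝ) : ℂ) := fun j => by
    rw [mul_comm, hγb]
  have hlt := norm_originValue_lt_one hC₁ hC₂ hφ.1
  have hns : ∀ e : ℂ, ‖e‖ = 1 → ‖(s : ℂ) * e‖ = s := fun e he => by
    rw [norm_mul, he, mul_one, Complex.norm_real, Real.norm_eq_abs, abs_of_pos hs]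
  rcases originDeriv_dichotomy hC₁ hC₂ hφ with ⟨h01, h10, h00, h11⟩ | ⟨h00, h11, h01, h10⟩
  -- `γ` makes the diagonal of the image real and nonnegative; the phases `e₀`, `e₁` of the source
  -- jet do the same for its superdiagonal.
  · obtain ⟨e₀, he₀, hm₀⟩ := exists_norm_one_mul_eq (γ 0 * originDeriv φ 0 0)
    obtain ⟨e₁, he₁, hm₁⟩ := exists_norm_one_mul_eq (γ 1 * originDeriv φ 1 1)
    rw [norm_mul, hγ, one_mul, h00] at hm₀
    rw [norm_mul, hγ, one_mul, h11] at hm₁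
    obtain ⟨q, hq⟩ := exists_rotated_jet hC₁ hC₂ hφ.1 hγ
      (nilTriple_mem_closedSpec hC₁ hC₂ hsle (x := ![s * e₀, e₁]) (y := ![e₀, s * e₁])
        (hns _ he₀) he₁ he₀ (hns _ he₁))
    have hb := eq_zero_of_diagonal_jet hC₁ hC₂ hs hs1 hv hv' (norm_nonneg (originValue φ 0))
      (norm_nonneg (originValue φ 1)) (q₀ := q 0) (q₁ := q 1) (by
        rw [hγb', Complex.ofReal_mul, ← hm₀]
        simp only [Fin.sum_univ_two, h01]
        congr 1 <;> simp <;> ring) (by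
        rw [hγb', Complex.ofReal_mul, ← hm₁]
        simp only [Fin.sum_univ_two, h10]
        congr 1 <;> simp <;> ring) hq
    rw [norm_eq_zero, norm_eq_zero] at hb
    refine ⟨by ext j; fin_cases j; exacts [hb.1, hb.2],
      fun j => originDeriv φ j j, fun j => ?_, ?_⟩
    · fin_cases j
      · simpa [hb.1] using h00
      · simpa [hb.2] using h11
    · ext i j
      fin_cases i <;> fin_cases j <;> simp [h01, h10]
  · exfalso
    obtain ⟨e₀, he₀, hm₀⟩ := exists_norm_one_mul_eq (γ 0 * originDeriv φ 0 1)
    obtain ⟨e₁, he₁, hm₁⟩ := exists_norm_one_mul_eq (γ 1 * originDeriv φ 1 0)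
    rw [norm_mul, hγ, one_mul, h01] at hm₀
    rw [norm_mul, hγ, one_mul, h10] at hm₁
    obtain ⟨q, hq⟩ := exists_rotated_jet hC₁ hC₂ hφ.1 hγ
      -- The derivative swaps coordinates, so source coordinate `0` carries the phase of image
      -- coordinate `1` and the weights arrive interchanged.
      (nilTriple_mem_closedSpec hC₁ hC₂ hsle (x := ![s * e₁, e₀]) (y := ![e₁, s * e₀])
        (hns _ he₁) he₀ he₁ (hns _ he₀))
    exact false_of_antidiagonal_jet hC₁ hC₂ hs hs1 hv hv' (norm_nonneg (originValue φ 0))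
      (norm_nonneg (originValue φ 1)) (hlt 0) (hlt 1) (q₀ := q 0) (q₁ := q 1) (by
        rw [hγb', Complex.ofReal_mul, ← hm₀]
        simp only [Fin.sum_univ_two, h00]
        congr 1 <;> simp <;> ring) (by
        rw [hγb', Complex.ofReal_mul, ← hm₁]
        simp only [Fin.sum_univ_two, h11]
        congr 1 <;> simp <;> ring) hq

theorem coeffMap_diagonal {g N : ℕ} (γ : Fin g → ℂ) (X : Tuple g N) :
    coeffMap (Matrix.diagonal γ) N X = fun j => γ j • X j := by
  ext1 i
  change ∑ j, Matrix.diagonal γ i j • X j = _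
  rw [Finset.sum_eq_single i]
  · simp
  · intro j _ hj
    rw [Matrix.diagonal_apply_ne _ hj.symm, zero_smul]
  · simp

/-- Undoing the rotation, which preserves the spectrahedron, leaves a self-map fixing `0` with
identity derivative; Cartan's theorem applies since the domain is bounded and balanced. -/
theorem map_eq_rotation (hC₁ : ‖C₁‖ = 1) (hC₂ : ‖C₂‖ = 1)
    (hφ : IsFreeAnalytic (blockPair C₁ C₂) (blockPair C₁ C₂) φ) (h0 : originValue φ = 0)
    {γ : Fin 2 → ℂ} (hγ : ∀ j, ‖γ j‖ = 1) (hd : originDeriv φ = Matrix.diagonal γ) {X : Tuple 2 N}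
    (hX : X ∈ interiorSpec (blockPair C₁ C₂) N) : φ N X = fun j => γ j • X j := by
  have hγ0 : ∀ j, γ j ≠ 0 := fun j h => by simpa [h] using hγ j
  set L := (coeffMap (Matrix.diagonal fun j => (γ j)⁻¹) N).toContinuousLinearMap with hL
  have hLapp : ∀ Y, L Y = fun j => (γ j)⁻¹ • Y j := fun Y => coeffMap_diagonal _ Y
  have hφ0 : φ N 0 = 0 := by
    rw [map_zero_eq hC₁ hC₂ hφ, h0]
    ext j
    simp
  have hz := zero_mem_interiorSpec (N := N) hC₁ hC₂
  have hcartan := eqOn_id_of_hasStrictFDerivAt_id (D := interiorSpec (blockPair C₁ C₂) N)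
    (f := fun Y => L (φ N Y)) (R := 1)
    (fun Y hY t ht => smul_mem_interiorSpec_of_mem hY ht)
    (fun Y hY => (pi_norm_le_iff_of_nonneg zero_le_one).2 fun j =>
      (interiorSpec_subset_freeBidisk hC₁ hC₂ hY j).le)
    (fun Y hY => by
      change L (φ N Y) ∈ _
      rw [hLapp]
      exact circle_smul_mem_interiorSpec (hφ.mapsTo N hY) _ fun j => by rw [norm_inv, hγ, inv_one])
    (fun Y hY => L.differentiableAt.comp Y (hφ.analytic N Y hY).differentiableAt)
    (by rw [hφ0, map_zero])
    (by
      have h1 := (hφ.analytic N 0 hz).hasStrictFDerivAt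
      have h2 := L.hasStrictFDerivAt.comp (0 : Tuple 2 N) h1
      have h3 : L.comp (fderiv ℂ (φ N) 0) = ContinuousLinearMap.id ℂ (Tuple 2 N) := by
        ext1 Y
        rw [ContinuousLinearMap.comp_apply, fderiv_zero_eq_coeffMap hC₁ hC₂ hφ, hd,
          coeffMap_diagonal, hLapp]
        ext1 j
        simp [smul_smul, hγ0]
      rw [h3] at h2
      exact h2)
  have := hcartan hX
  simp only [hLapp, id_eq] at this
  ext1 j
  rw [← congrFun this j, smul_smul, mul_inv_cancel₀ (hγ0 j), one_smul]

end ThreeJets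

end FreeSpec

end

theorem theorem1p1 {k m n : ℕ} (C₁ : Matrix (Fin k) (Fin m) ℂ) (C₂ : Matrix (Fin m) (Fin n) ℂ)
    (hC₁ : ‖C₁‖ = 1) (hC₂ : ‖C₂‖ = 1) :
    ((1 - (C₁ᴴ * C₁ + C₂ * C₂ᴴ)).PosSemidef →
      ∀ N, FreeSpec.interiorSpec (FreeSpec.blockPair C₁ C₂) N = FreeSpec.freeBidisk N) ∧
    (¬ (1 - (C₁ᴴ * C₁ + C₂ * C₂ᴴ)).PosSemidef →
      ∀ φ : (∀ N, FreeSpec.Tuple 2 N → FreeSpec.Tuple 2 N),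
        FreeSpec.IsFreeBianalytic (FreeSpec.blockPair C₁ C₂) (FreeSpec.blockPair C₁ C₂) φ →
        ∃ γ : Fin 2 → Circle, ∀ N, ∀ X ∈ FreeSpec.interiorSpec (FreeSpec.blockPair C₁ C₂) N,
          φ N X = fun j => (γ j : ℂ) • X j) := by
  refine ⟨fun hC N => FreeSpec.interiorSpec_eq_freeBidisk hC₁ hC₂ hC, fun hC φ hφ => ?_⟩
  obtain ⟨h0, γ, hγ, hd⟩ := FreeSpec.origin_data hC₁ hC₂ hC hφ
  exact ⟨fun j => ⟨γ j, mem_sphere_zero_iff_norm.2 (hγ j)⟩, fun N X hX =>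
    FreeSpec.map_eq_rotation hC₁ hC₂ hφ.1 h0 hγ hd hX⟩
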